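/- Let $\alpha>0$ and $2<p<\infty$. Let $\mathcal F^p_\alpha$ be the space of entire functions $f$ with $\|f\|_p^p:=\int_{\mathbb C}|f(z)|^p e^{-p\alpha|z|^2/2}\,dm(z)<\infty$, where $dm$ is area measure. A divisor is a family $X=\{(\lambda,m_\lambda)\}_{\lambda\in\Lambda}$, where $\Lambda\subset\mathbb C$ is a countable set and each $m_\lambda\ge 1$ is an integer. Put $N_\lambda^p=\{f\in\mathcal F^p_\alpha: f(\lambda)=f'(\lambda)=\dots=f^{(m_\lambda-1)}(\lambda)=0\}$ and $\|f\|_{\mathcal F^p_\alpha/N^p_\lambda}=\inf_{g\in N^p_\lambda}\|f-g\|_p$. The divisor $X$ is *sampling* for $\mathcal F^p_\alpha$ if there are constants $A,B>0$ such that $$A\|f\|_p^p\le\sum_{\lambda\in\Lambda}\|f\|^p_{\mathcal F^p_\alpha/N^p_\lambda}\le B\|f\|_p^p\qquad\text{for all } f\in\mathcal F^p_\alpha .$$ Write $D(\lambda,r)$ for the open disc with centre $\lambda$ and radius $r$. The divisor $X$ satisfies the *finite overlap condition* if $$S_X=\sup_{z\in\mathbb C}\sum_{\lambda\in\Lambda}\chi_{D(\lambda,\sqrt{m_\lambda/\alpha})}(z)<\infty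 .$$ **Theorem 8.1.** (a) If $X$ is a sampling divisor for $\mathcal F^p_\alpha$, then $X$ satisfies the finite overlap condition and there exists $C>0$ such that $\bigcup_{\lambda\in\Lambda}D(\lambda,\sqrt{m_\lambda/\alpha}+C)=\mathbb C$. (b) For every $S\in[0,\infty)$ there exists $C>0$, depending only on $S$, $\alpha$ and $p$, such that every divisor $X$ with $S_X\le S$ has the following property: if for some compact $K\subset\mathbb C$ $$\bigcup_{\lambda\in\Lambda,\ m_\lambda>\alpha C^2}D(\lambda,\sqrt{m_\lambda/\alpha}-C)=\mathbb C\setminus K,$$ then $X$ is a sampling divisor for $\mathcal F^p_\alpha$. -/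

import Mathlib

open scoped NNReal ENNReal

noncomputable section

namespace Fock

/-- A divisor `X = {(l, m_l)}_{l ∈ Λ}`: a countable set `Λ` of points of the plane, each carrying a
positive integer multiplicity. It is encoded by its multiplicity function, which is `0` off `Λ`. -/
structure Divisor where
  mult : ℂ → ℕ
  countable_support : (Function.support mult).Countable

namespace Divisor

/-- The set `Λ` of points of the divisor. -/
def points (X : Divisor) : Set ℂ := Function.support X.mult

/-- The radius `√(m_l / α)` attached to the point `l`. -/
def radius (X : Divisor) (α : ℝ) (l : ℂ) : ℝ := Real.sqrt ((X.mult l : ℝ) / α)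

/-- `S_X = sup_z ∑_{l ∈ Λ} χ_{D(l, √(m_l/α))}(z)`. -/
def overlap (X : Divisor) (α : ℝ) : ℝ≥0∞ :=
  ⨆ z : ℂ, ∑' l : X.points,
    (Metric.ball (l : ℂ) (X.radius α l)).indicator (fun _ => (1 : ℝ≥0∞)) z

/-- The finite overlap condition `S_X < ∞`. -/
def FiniteOverlap (X : Divisor) (α : ℝ) : Prop := X.overlap α < ∞

end Divisor

/-- The function `f(z) exp(-α|z|²/2)`. -/
def weighted (α : ℝ) (f : ℂ → ℂ) : ℂ → ℂ :=
  fun z => f z * (Real.exp (-α * ‖z‖ ^ 2 / 2) : ℂ)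

/-- The Fock space `F^p_α`: entire functions `f` with `f(z) exp(-α|z|²/2)` in `L^p(ℂ)`. -/
def space (α p : ℝ) : Set (ℂ → ℂ) :=
  {f | Differentiable ℂ f ∧ MeasureTheory.MemLp (weighted α f) (ENNReal.ofReal p)
    MeasureTheory.volume}

/-- The norm `(∫ |f(z)|^p exp(-pα|z|²/2) dm(z))^(1/p)`, as an extended nonnegative number. -/
def norm (α p : ℝ) (f : ℂ → ℂ) : ℝ≥0∞ :=
  MeasureTheory.eLpNorm (weighted α f) (ENNReal.ofReal p) MeasureTheory.volume

/-- The subspace `N^p_{l,m}` of the `f ∈ F^p_α` with `f(l) = f'(l) = ⋯ = f^(m-1)(l) = 0`. -/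
def vanishing (α p : ℝ) (l : ℂ) (m : ℕ) : Set (ℂ → ℂ) :=
  {f | f ∈ space α p ∧ ∀ k < m, iteratedDeriv k f l = 0}

/-- The quotient norm of (the class of) `f` in `F^p_α / N^p_{l,m}`. -/
def quotientNorm (α p : ℝ) (l : ℂ) (m : ℕ) (f : ℂ → ℂ) : ℝ≥0∞ :=
  ⨅ g ∈ vanishing α p l m, norm α p (f - g)

/-- `X` is sampling for `F^p_α`: `‖f‖^p ≍ ∑_{l ∈ Λ} ‖f‖^p_{F^p_α / N^p_{l, m_l}}` on `F^p_α`. -/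
def Divisor.IsSampling (X : Divisor) (α p : ℝ) : Prop :=
  ∃ A B : ℝ≥0, 0 < A ∧ 0 < B ∧ ∀ f ∈ space α p,
    A * norm α p f ^ p ≤ ∑' l : X.points, quotientNorm α p l (X.mult l) f ^ p ∧
    ∑' l : X.points, quotientNorm α p l (X.mult l) f ^ p ≤ B * norm α p f ^ p

end Fock

end

/-! Everything rests on one local mechanism. For an entire function `f`, the difference between the
Cauchy integral and the Taylor polynomial of degree less than `n` has kernel `(z/ζ)^n / (ζ - z)`.
Averaging over a window of about `√m` degrees, three times, improves the decay of this kernel to `|z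
- ζ|⁻⁴` in the Gaussian weight, for `ζ` near the circle `|ζ| = √(m/α)`, where monomials of degree
about `m` peak. Integrating over an annulus of width one and translating by Fock isometries gives
two estimates. If `f` vanishes to order `m` at `l`, its values at depth `t + 1` inside `D(l,
√(m/α))` are bounded by a convolution with the kernel cut off at `|w| ≥ t`, of small mass for large
`t` (`inner_estimate`). Any `m`-jet of `f` is also the jet of a function controlled by `f` on `D(l,
√(m/α) + 4)` (`outer_estimate`). Young's inequality turns both into `L^p` bounds for quotient norms
(`setLIntegral_le_quotientNorm`, `quotientNorm_rpow_le`).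

Necessity: normalized reproducing kernels are Gaussian bumps. Each disc that contains the centre of
a bump well inside, or whose radius is bounded, captures a fixed part of its norm, so the upper
sampling bound limits the overlap. A bump far from all discs has small quotient norms, so the lower
bound forces the covering.

Sufficiency: the upper bound follows from the outer estimate and bounded overlap. For the lower
bound, the inner estimates are summed over the covering discs and the small error is absorbed. The
compact set `K` is handled by adding a fictitious point at the origin, whose quotient has finite
dimension (`norm_rpow_le_apriori`). A compactness argument removes this term, provided no nonzero
function of the space vanishes on `X` (`eq_zero_of_vanishing`). This uniqueness holds because the
absorption survives a weight of linear growth: iterating it bounds the norms of `z^k f`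
geometrically, which forces `f` to vanish far out. -/

noncomputable section

namespace Fock

/-! ### Averaged Taylor polynomials and their Cauchy kernels. -/

section Kernel

open MeasureTheory Finset

/-- The Taylor polynomial at the origin, of degree less than `n`. -/
def taylorPoly (f : ℂ → ℂ) (n : ℕ) (z : ℂ) : ℂ :=
  ∑ k ∈ range n, iteratedDeriv k f 0 / k.factorial * z ^ k

lemma taylorPoly_eq_circleIntegral {f : ℂ → ℂ} (hf : Differentiable ℂ f) {ρ : ℝ} (hρ : 0 < ρ)
    (n : ℕ) (z : ℂ) :
    taylorPoly f n z =
      (2 * Real.pi * Complex.I)⁻¹ * ∮ ζ in C(0, ρ), f ζ * ∑ k ∈ range n, z ^ k / ζ ^ (k + 1) := by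
  have hI := Complex.two_pi_I_ne_zero
  have h0 : ∀ ζ ∈ Metric.sphere (0 : ℂ) ρ, ζ ≠ 0 := fun ζ hζ h ↦ by
    simp [h, hρ.ne] at hζ
  have hc (k : ℕ) : CircleIntegrable (fun ζ ↦ z ^ k * ((1 / (ζ - 0) ^ (k + 1)) • f ζ)) 0 ρ := by
    refine ContinuousOn.circleIntegrable hρ.le ?_
    have := hf.continuous
    refine continuousOn_const.mul (ContinuousOn.smul (continuousOn_const.div
      ((continuousOn_id.sub continuousOn_const).pow _) fun ζ hζ ↦ ?_) this.continuousOn)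
    simpa using h0 ζ hζ
  have : ∀ ζ, f ζ * ∑ k ∈ range n, z ^ k / ζ ^ (k + 1)
      = ∑ k ∈ range n, z ^ k * ((1 / (ζ - 0) ^ (k + 1)) • f ζ) := fun ζ ↦ by
    rw [mul_sum]; refine sum_congr rfl fun k _ ↦ ?_
    simp only [sub_zero, smul_eq_mul]; ring
  simp_rw [this]
  rw [circleIntegral.integral_fun_sum fun k _ ↦ hc k, mul_sum, taylorPoly]
  refine sum_congr rfl fun k _ ↦ ?_
  rw [circleIntegral.integral_const_mul,
    hf.differentiableOn.circleIntegral_one_div_sub_center_pow_smul hρ k, smul_eq_mul]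
  field_simp

lemma geom_kernel (n : ℕ) {z ζ : ℂ} (h0 : ζ ≠ 0) (h : ζ ≠ z) :
    ∑ k ∈ range n, z ^ k / ζ ^ (k + 1) = (1 - (z / ζ) ^ n) / (ζ - z) := by
  have h' : ζ - z ≠ 0 := sub_ne_zero.2 h
  have h1 : z / ζ ≠ 1 := fun e ↦ h ((div_eq_one_iff_eq h0).1 e).symm
  have : ∀ k, z ^ k / ζ ^ (k + 1) = ζ⁻¹ * (z / ζ) ^ k := fun k ↦ by
    rw [div_pow]; field_simp; ring
  simp_rw [this, ← mul_sum]
  rw [geom_sum_eq h1]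
  have : z - ζ ≠ 0 := sub_ne_zero.2 (Ne.symm h)
  have e : z / ζ - 1 = -((ζ - z) / ζ) := by field_simp; ring
  rw [e]
  field_simp
  ring

/-- The Taylor polynomial replaces the Cauchy kernel by a partial geometric sum, and `(z/ζ)^n / (ζ -
z)` is the remainder. Outside the circle the Cauchy integral is zero and the same kernel represents
the polynomial alone; this case later controls it far from the disc. -/
lemma circleIntegral_pow_kernel {f : ℂ → ℂ} (hf : Differentiable ℂ f) {ρ : ℝ} (hρ : 0 < ρ)
    (n : ℕ) {z : ℂ} (hz : ‖z‖ ≠ ρ) :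
    ((2 * Real.pi * Complex.I)⁻¹ * ∮ ζ in C(0, ρ), f ζ * ((z / ζ) ^ n / (ζ - z))) =
      (if ‖z‖ < ρ then f z else 0) - taylorPoly f n z := by
  have hI := Complex.two_pi_I_ne_zero
  have h0 : ∀ ζ ∈ Metric.sphere (0 : ℂ) ρ, ζ ≠ 0 := fun ζ hζ h ↦ by
    simp [h, hρ.ne] at hζ
  have h1 : ∀ ζ ∈ Metric.sphere (0 : ℂ) ρ, ζ ≠ z := fun ζ hζ h ↦ by
    rw [h] at hζ; simp at hζ; exact hz hζ
  have hfc := hf.continuous.continuousOn (s := Metric.sphere (0 : ℂ) ρ)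
  have cauchy : ((2 * Real.pi * Complex.I)⁻¹ * ∮ ζ in C(0, ρ), (ζ - z)⁻¹ • f ζ) =
      if ‖z‖ < ρ then f z else 0 := by
    split_ifs with h
    · rw [hf.differentiableOn.circleIntegral_sub_inv_smul (by simpa using h), smul_eq_mul]
      field_simp
    · have hlt : ρ < ‖z‖ := lt_of_le_of_ne (not_lt.1 h) (Ne.symm hz)
      have hne : ∀ ζ ∈ Metric.closedBall (0 : ℂ) ρ, ζ - z ≠ 0 := fun ζ hζ e ↦ by
        rw [sub_eq_zero.1 e] at hζ; simp at hζ; linarith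
      rw [Complex.circleIntegral_eq_zero_of_differentiable_on_off_countable hρ.le
        Set.countable_empty, mul_zero]
      · exact (ContinuousOn.inv₀ (by fun_prop) hne).smul hf.continuous.continuousOn
      · intro ζ hζ
        have := hne ζ (Metric.ball_subset_closedBall hζ.1)
        exact ((differentiableAt_id.sub_const z).inv this).smul (hf ζ)
  rw [taylorPoly_eq_circleIntegral hf hρ, ← cauchy, ← mul_sub, ← circleIntegral.integral_sub]
  · congr 1
    refine circleIntegral.integral_congr hρ.le fun ζ hζ ↦ ?_
    have := sub_ne_zero.2 (h1 ζ hζ)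
    simp only [geom_kernel n (h0 ζ hζ) (h1 ζ hζ), smul_eq_mul]
    field_simp
    ring
  · exact ((ContinuousOn.inv₀ (by fun_prop) fun ζ hζ ↦ sub_ne_zero.2 (h1 ζ hζ)).smul
      hfc).circleIntegrable hρ.le
  · refine (hfc.mul (continuousOn_finsetSum _ fun k _ ↦ continuousOn_const.div (by fun_prop)
      fun ζ hζ ↦ pow_ne_zero _ (h0 ζ hζ))).circleIntegrable hρ.le

/-- The average of the Taylor polynomials of `f` of degree less than `n + i + j + k`, over
`i, j, k < N`. -/
def avgTaylor (f : ℂ → ℂ) (n N : ℕ) (z : ℂ) : ℂ :=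
  ((N : ℂ)⁻¹) ^ 3 * ∑ i ∈ range N, ∑ j ∈ range N, ∑ k ∈ range N, taylorPoly f (n + i + j + k) z

/-- The average of the powers `q ^ (n + i + j + k)` over `i, j, k < N`. -/
def avgPow (n N : ℕ) (q : ℂ) : ℂ := q ^ n * ((N : ℂ)⁻¹ * ∑ j ∈ range N, q ^ j) ^ 3

lemma avgPow_eq_sum (n N : ℕ) (q : ℂ) :
    avgPow n N q = ((N : ℂ)⁻¹) ^ 3 *
      ∑ i ∈ range N, ∑ j ∈ range N, ∑ k ∈ range N, q ^ (n + i + j + k) := by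
  have : ∑ i ∈ range N, ∑ j ∈ range N, ∑ k ∈ range N, q ^ (n + i + j + k) =
      q ^ n * ((∑ i ∈ range N, q ^ i) * ((∑ i ∈ range N, q ^ i) * ∑ i ∈ range N, q ^ i)) := by
    rw [sum_mul_sum, sum_mul_sum, mul_sum]
    simp only [mul_sum, pow_add, mul_assoc]
  rw [this, avgPow]; ring

lemma circleIntegral_avgPow {f : ℂ → ℂ} (hf : Differentiable ℂ f) {ρ : ℝ} (hρ : 0 < ρ)
    (n : ℕ) {N : ℕ} (hN : N ≠ 0) {z : ℂ} (hz : ‖z‖ ≠ ρ) :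
    ((2 * Real.pi * Complex.I)⁻¹ * ∮ ζ in C(0, ρ), f ζ * (avgPow n N (z / ζ) / (ζ - z))) =
      (if ‖z‖ < ρ then f z else 0) - avgTaylor f n N z := by
  have h0 : ∀ ζ ∈ Metric.sphere (0 : ℂ) ρ, ζ ≠ 0 := fun ζ hζ h ↦ by
    simp [h, hρ.ne] at hζ
  have h1 : ∀ ζ ∈ Metric.sphere (0 : ℂ) ρ, ζ ≠ z := fun ζ hζ h ↦ by
    rw [h] at hζ; simp at hζ; exact hz hζ
  have hfc := hf.continuous.continuousOn (s := Metric.sphere (0 : ℂ) ρ)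
  have hci (m : ℕ) : CircleIntegrable (fun ζ ↦ f ζ * ((z / ζ) ^ m / (ζ - z))) 0 ρ :=
    (hfc.mul (((continuousOn_const.div continuousOn_id h0).pow m).div (by fun_prop)
      fun ζ hζ ↦ sub_ne_zero.2 (h1 ζ hζ))).circleIntegrable hρ.le
  have e : ∀ ζ, f ζ * (avgPow n N (z / ζ) / (ζ - z)) = ((N : ℂ)⁻¹) ^ 3 *
      ∑ i ∈ range N, ∑ j ∈ range N, ∑ k ∈ range N,
        f ζ * ((z / ζ) ^ (n + i + j + k) / (ζ - z)) := fun ζ ↦ by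
    rw [avgPow_eq_sum, mul_div_assoc, mul_left_comm]
    simp_rw [sum_div, mul_sum]
  simp_rw [e]
  rw [circleIntegral.integral_const_mul, mul_left_comm, circleIntegral.integral_fun_sum]
  swap
  · exact fun i _ ↦ CircleIntegrable.fun_sum _ fun j _ ↦ CircleIntegrable.fun_sum _ fun k _ ↦ hci _
  simp_rw [circleIntegral.integral_fun_sum fun j _ ↦ CircleIntegrable.fun_sum _ fun k _ ↦ hci _,
    circleIntegral.integral_fun_sum fun k _ ↦ hci _, mul_sum,
    circleIntegral_pow_kernel hf hρ _ hz]
  simp only [sum_sub_distrib, sum_const, card_range, avgTaylor, mul_sum, mul_sub, nsmul_eq_mul]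
  have : (N : ℂ) ≠ 0 := by exact_mod_cast hN
  congr 1
  field_simp

/-- Each average of a geometric progression gains a factor `1 / (N |q - 1|)`. For `q = z/ζ` and `N`
at least a multiple of `|ζ|`, this is a gain of `1 / |z - ζ|`. Three averages leave `|z - ζ|⁻⁴`,
which stays integrable at infinity in the plane after multiplication by `1 + |z - ζ|`; two would not
suffice. -/
lemma norm_avgPow_le (n N : ℕ) {q : ℂ} (hq : q ≠ 1) :
    ‖avgPow n N q‖ ≤ 8 * (‖q‖ ^ n + ‖q‖ ^ (n + 3 * N)) / (N * ‖q - 1‖) ^ 3 := by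
  have hq' : 0 < ‖q - 1‖ := norm_pos_iff.2 (sub_ne_zero.2 hq)
  have h1 : ‖∑ j ∈ range N, q ^ j‖ ≤ (1 + ‖q‖ ^ N) / ‖q - 1‖ := by
    rw [geom_sum_eq hq, norm_div]
    gcongr
    refine (norm_sub_le _ _).trans ?_
    rw [norm_pow, norm_one, add_comm]
  rw [avgPow, norm_mul, norm_pow, norm_pow, norm_mul, norm_inv, Complex.norm_natCast]
  have h2 : (1 + ‖q‖ ^ N) ^ 3 ≤ 8 * (1 + ‖q‖ ^ (3 * N)) := by
    rw [mul_comm 3 N, pow_mul]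
    have : 0 ≤ ‖q‖ ^ N := by positivity
    generalize ‖q‖ ^ N = x at *
    nlinarith [mul_nonneg this (sq_nonneg (x - 1)), sq_nonneg (x-1), sq_nonneg (x+1)]
  calc ‖q‖ ^ n * ((N : ℝ)⁻¹ * ‖∑ j ∈ range N, q ^ j‖) ^ 3
      ≤ ‖q‖ ^ n * ((N : ℝ)⁻¹ * ((1 + ‖q‖ ^ N) / ‖q - 1‖)) ^ 3 := by gcongr
    _ = ‖q‖ ^ n * (1 + ‖q‖ ^ N) ^ 3 * ((N * ‖q - 1‖) ^ 3)⁻¹ := by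
        rw [mul_pow, div_pow, mul_pow, inv_pow, mul_inv]; ring
    _ ≤ ‖q‖ ^ n * (8 * (1 + ‖q‖ ^ (3 * N))) * ((N * ‖q - 1‖) ^ 3)⁻¹ := by gcongr
    _ = _ := by rw [pow_add]; ring

/-- A bound that holds on every circle `|ζ| = ρ`, `s < ρ < s + 1`, holds for the integral over the
annulus. -/
lemma le_lintegral_annulus {s : ℝ} (hs : 0 ≤ s) {X : ℝ≥0∞} {u : ℂ → ℝ≥0∞} (hu : Measurable u)
    (h : ∀ ρ ∈ Set.Ioo s (s + 1), X ≤ ∫⁻ θ in Set.Ioo (-Real.pi) Real.pi,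
      ENNReal.ofReal ρ * u (circleMap 0 ρ θ)) :
    X ≤ ∫⁻ ζ in {ζ : ℂ | s < ‖ζ‖ ∧ ‖ζ‖ < s + 1}, u ζ := by
  have hA : MeasurableSet {ζ : ℂ | s < ‖ζ‖ ∧ ‖ζ‖ < s + 1} :=
    (measurableSet_lt measurable_const measurable_norm).inter
      (measurableSet_lt measurable_norm measurable_const)
  set A := {ζ : ℂ | s < ‖ζ‖ ∧ ‖ζ‖ < s + 1}
  rw [← lintegral_indicator hA, ← Complex.lintegral_comp_polarCoord_symm]
  have hcm : Measurable fun x : ℝ × ℝ ↦ Complex.polarCoord.symm x := by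
    have : (fun x : ℝ × ℝ ↦ Complex.polarCoord.symm x) =
      fun x : ℝ × ℝ ↦ (x.1 * (Real.cos x.2 + Real.sin x.2 * Complex.I) : ℂ) := by
        ext x; rw [Complex.polarCoord_symm_apply]
    rw [this]; fun_prop
  have hm : Measurable fun x : ℝ × ℝ ↦ ENNReal.ofReal x.1 • A.indicator u
      (Complex.polarCoord.symm x) :=
    (by fun_prop : Measurable fun x : ℝ × ℝ ↦ ENNReal.ofReal x.1).smul
      ((hu.indicator hA).comp hcm)
  rw [show polarCoord.target = Set.Ioi (0 : ℝ) ×ˢ Set.Ioo (-Real.pi) Real.pi from rfl,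
    Measure.volume_eq_prod, ← Measure.prod_restrict, lintegral_prod _ hm.aemeasurable]
  calc X = ∫⁻ ρ in Set.Ioo s (s + 1), X := by simp
    _ ≤ ∫⁻ ρ in Set.Ioo s (s + 1), ∫⁻ θ in Set.Ioo (-Real.pi) Real.pi,
        ENNReal.ofReal ρ • A.indicator u (Complex.polarCoord.symm (ρ, θ)) := by
        refine setLIntegral_mono' measurableSet_Ioo fun ρ hρ ↦ (h ρ hρ).trans (le_of_eq ?_)
        refine lintegral_congr fun θ ↦ ?_
        have e : Complex.polarCoord.symm (ρ, θ) = circleMap 0 ρ θ := by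
          rw [Complex.polarCoord_symm_apply, circleMap_zero, Complex.exp_mul_I]
          simp
        have : circleMap 0 ρ θ ∈ A := by
          have : ‖circleMap 0 ρ θ‖ = ρ := by
            rw [norm_circleMap_zero, abs_of_pos (hs.trans_lt hρ.1)]
          exact ⟨by rw [this]; exact hρ.1, by rw [this]; exact hρ.2⟩
        rw [e, Set.indicator_of_mem this, smul_eq_mul]
    _ ≤ _ := lintegral_mono_set fun ρ hρ ↦ hs.trans_lt hρ.1

lemma enorm_circleIntegral_le {F : ℂ → ℂ} {ρ : ℝ} (hρ : 0 < ρ) :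
    ‖(2 * Real.pi * Complex.I)⁻¹ * ∮ ζ in C(0, ρ), F ζ‖ₑ ≤
      ∫⁻ θ in Set.Ioo (-Real.pi) Real.pi, ENNReal.ofReal ρ * ‖F (circleMap 0 ρ θ)‖ₑ := by
  -- Periodicity moves the integral from `[0, 2π]` to `(-π, π)`, the angular range of polar
  -- coordinates.
  have hper : Function.Periodic (fun θ ↦ deriv (circleMap 0 ρ) θ • F (circleMap 0 ρ θ))
      (2 * Real.pi) := fun θ ↦ by
    simp only [deriv_circleMap, periodic_circleMap 0 ρ θ]
  have e : (∮ ζ in C(0, ρ), F ζ) =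
      ∫ θ in Set.Ioo (-Real.pi) Real.pi, deriv (circleMap 0 ρ) θ • F (circleMap 0 ρ θ) := by
    rw [circleIntegral]
    have := hper.intervalIntegral_add_eq 0 (-Real.pi)
    rw [zero_add] at this
    rw [this, show -Real.pi + 2 * Real.pi = Real.pi by ring,
      intervalIntegral.integral_of_le (by linarith [Real.pi_pos]), integral_Ioc_eq_integral_Ioo]
  rw [enorm_mul, e]
  have h1 : ‖(2 * Real.pi * Complex.I : ℂ)⁻¹‖ₑ ≤ 1 := by
    rw [← ofReal_norm, ← ENNReal.ofReal_one]
    refine ENNReal.ofReal_le_ofReal ?_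
    simp only [mul_inv_rev, norm_mul, norm_inv, Complex.norm_I, inv_one, one_mul,
      Complex.norm_real, Real.norm_eq_abs, abs_of_pos Real.pi_pos]
    have := Real.pi_gt_three
    rw [← mul_inv]
    refine inv_le_one_of_one_le₀ ?_
    norm_num; linarith
  calc _ ≤ 1 * ∫⁻ θ in Set.Ioo (-Real.pi) Real.pi,
        ‖deriv (circleMap 0 ρ) θ • F (circleMap 0 ρ θ)‖ₑ := by
        gcongr; exact enorm_integral_le_lintegral_enorm _
    _ = _ := by
        rw [one_mul]
        refine lintegral_congr fun θ ↦ ?_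
        rw [smul_eq_mul, enorm_mul, deriv_circleMap, enorm_mul]
        congr 1
        rw [← ofReal_norm, ← ofReal_norm, norm_circleMap_zero, abs_of_pos hρ]; simp

lemma enorm_sub_avgTaylor_le {f : ℂ → ℂ} (hf : Differentiable ℂ f) {s : ℝ} (hs : 0 ≤ s)
    (n : ℕ) {N : ℕ} (hN : N ≠ 0) {z : ℂ} (hz : ‖z‖ ≤ s ∨ s + 1 ≤ ‖z‖) :
    ‖(if ‖z‖ ≤ s then f z else 0) - avgTaylor f n N z‖ₑ ≤
      ∫⁻ ζ in {ζ : ℂ | s < ‖ζ‖ ∧ ‖ζ‖ < s + 1}, ‖f ζ‖ₑ * ‖avgPow n N (z / ζ) / (ζ - z)‖ₑ := by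
  have hf' : Measurable f := hf.continuous.measurable
  refine le_lintegral_annulus hs ?_ fun ρ hρ ↦ ?_
  · unfold avgPow
    fun_prop
  · have hρ0 : 0 < ρ := hs.trans_lt hρ.1
    have hne : ‖z‖ ≠ ρ := by
      rintro rfl; rcases hz with h | h <;> linarith [hρ.1, hρ.2]
    have hiff : ‖z‖ ≤ s ↔ ‖z‖ < ρ :=
      ⟨fun h ↦ h.trans_lt hρ.1, fun h ↦ hz.resolve_right fun h' ↦ by linarith [hρ.2]⟩
    simp_rw [hiff, ← circleIntegral_avgPow hf hρ0 n hN hne, ← enorm_mul]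
    exact enorm_circleIntegral_le hρ0

end Kernel

/-! ### Local estimates at the origin, and Fock translations. -/

section LocalAtOrigin

open MeasureTheory Finset

lemma enorm_weighted (α : ℝ) (f : ℂ → ℂ) (z : ℂ) :
    ‖weighted α f z‖ₑ = ‖f z‖ₑ * ENNReal.ofReal (Real.exp (-α * ‖z‖ ^ 2 / 2)) := by
  rw [weighted, enorm_mul, ← ofReal_norm (Real.exp _ : ℂ), Complex.norm_real, Real.norm_eq_abs,
    abs_of_pos (Real.exp_pos _)]

/-- Put `y = r/ρ` and `b = √α ρ`. Since `y^k ≤ exp(k (y - 1))`, the exponent is at most `(k - b²)(y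
- 1) - b²(y - 1)²/2 - b²/2`, and completing the square costs `d²/2`. Thus degrees within `O(ρ)` of
`αρ²` transfer the Gaussian weight from `r` to `ρ` at the price of a constant. -/
lemma pow_mul_exp_le {α r ρ d : ℝ} (hα : 0 < α) (hr : 0 ≤ r) (hρ : 0 < ρ) (k : ℕ)
    (hk : |k - α * ρ ^ 2| ≤ d * (√α * ρ)) :
    (r / ρ) ^ k * Real.exp (-α * r ^ 2 / 2) ≤
      Real.exp (d ^ 2 / 2) * Real.exp (-α * ρ ^ 2 / 2) := by
  set y := r / ρ with hy
  have hr' : r = y * ρ := by rw [hy]; field_simp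
  have hy0 : 0 ≤ y := by positivity
  have h1 : y ^ k ≤ Real.exp (k * (y - 1)) := by
    rw [Real.exp_nat_mul]
    gcongr
    have := Real.add_one_le_exp (y - 1)
    linarith
  have hs : (√α * ρ) ^ 2 = α * ρ ^ 2 := by rw [mul_pow, Real.sq_sqrt hα.le]
  have hp : 0 < √α * ρ := by positivity
  calc y ^ k * Real.exp (-α * r ^ 2 / 2)
      ≤ Real.exp (k * (y - 1)) * Real.exp (-α * r ^ 2 / 2) := by gcongr
    _ ≤ _ := by
      rw [← Real.exp_add, ← Real.exp_add]
      refine Real.exp_le_exp.2 ?_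
      rw [hr']
      have e : -α * (y * ρ) ^ 2 / 2 = - (√α * ρ) ^ 2 * y ^ 2 / 2 := by rw [hs]; ring
      have e' : -α * ρ ^ 2 / 2 = - (√α * ρ) ^ 2 / 2 := by rw [hs]; ring
      rw [← hs] at hk
      rw [e, e']
      generalize √α * ρ = b at *
      have h2 : (k - b ^ 2) * (y - 1) ≤ d * b * |y - 1| :=
        (le_abs_self _).trans (by rw [abs_mul]; gcongr)
      have h3 : d * b * |y - 1| ≤ d ^ 2 / 2 + b ^ 2 * (y - 1) ^ 2 / 2 := by
        rw [← sq_abs (y - 1)]; nlinarith [sq_nonneg (d - b * |y - 1|)]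
      nlinarith

lemma norm_avgPow_div_mul_exp_le {α c d : ℝ} (hα : 0 < α) {n N : ℕ} (hN : N ≠ 0) {z ζ : ℂ}
    (hζ : ζ ≠ 0) (hne : z ≠ ζ) (h1 : |n - α * ‖ζ‖ ^ 2| ≤ d * (√α * ‖ζ‖))
    (h2 : |((n + 3 * N : ℕ) : ℝ) - α * ‖ζ‖ ^ 2| ≤ d * (√α * ‖ζ‖)) (h3 : ‖ζ‖ ≤ c * N) :
    ‖avgPow n N (z / ζ) / (ζ - z)‖ * Real.exp (-α * ‖z‖ ^ 2 / 2) ≤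
      16 * Real.exp (d ^ 2 / 2) * c ^ 3 * (‖z - ζ‖ ^ 4)⁻¹ * Real.exp (-α * ‖ζ‖ ^ 2 / 2) := by
  have hq : z / ζ ≠ 1 := fun e ↦ hne ((div_eq_one_iff_eq hζ).1 e)
  have hζ' : 0 < ‖ζ‖ := norm_pos_iff.2 hζ
  have hd : 0 < ‖z - ζ‖ := norm_pos_iff.2 (sub_ne_zero.2 hne)
  have hN' : (0 : ℝ) < N := by exact_mod_cast Nat.pos_of_ne_zero hN
  have hq1 : ‖z / ζ - 1‖ = ‖z - ζ‖ / ‖ζ‖ := by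
    rw [← norm_div]; congr 1; field_simp
  have A := norm_avgPow_le n N hq
  rw [hq1, norm_div z ζ] at A
  have B1 := pow_mul_exp_le hα (norm_nonneg z) hζ' n h1
  have B2 := pow_mul_exp_le hα (norm_nonneg z) hζ' (n + 3 * N) h2
  have hcN : ‖ζ‖ / N ≤ c := by rwa [div_le_iff₀ hN']
  rw [norm_div, norm_sub_rev ζ z]
  calc _ ≤ 8 * ((‖z‖ / ‖ζ‖) ^ n + (‖z‖ / ‖ζ‖) ^ (n + 3 * N)) / (N * (‖z - ζ‖ / ‖ζ‖)) ^ 3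
        / ‖z - ζ‖ * Real.exp (-α * ‖z‖ ^ 2 / 2) := by gcongr
    _ = 8 * ((‖z‖ / ‖ζ‖) ^ n * Real.exp (-α * ‖z‖ ^ 2 / 2) +
          (‖z‖ / ‖ζ‖) ^ (n + 3 * N) * Real.exp (-α * ‖z‖ ^ 2 / 2)) * (‖ζ‖ / N) ^ 3
          * (‖z - ζ‖ ^ 4)⁻¹ := by field_simp
    _ ≤ 8 * (Real.exp (d ^ 2 / 2) * Real.exp (-α * ‖ζ‖ ^ 2 / 2) +
          Real.exp (d ^ 2 / 2) * Real.exp (-α * ‖ζ‖ ^ 2 / 2)) * c ^ 3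
          * (‖z - ζ‖ ^ 4)⁻¹ := by gcongr
    _ = _ := by ring

/-- The kernel `|w|⁻⁴`, restricted to `|w| ≥ t`. -/
def kernel (t : ℝ) (w : ℂ) : ℝ≥0∞ :=
  {w : ℂ | t ≤ ‖w‖}.indicator (fun w ↦ ENNReal.ofReal (‖w‖ ^ 4)⁻¹) w

lemma measurable_kernel (t : ℝ) : Measurable (kernel t) :=
  Measurable.indicator (by fun_prop) (measurableSet_le measurable_const measurable_norm)

lemma enorm_sub_avgTaylor_weighted_le {α c d : ℝ} (hα : 0 < α) (hc : 0 ≤ c) {n N : ℕ}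
    (hN : N ≠ 0) {f : ℂ → ℂ} (hf : Differentiable ℂ f) {s t r : ℝ} (hs : 0 ≤ s) (ht : 0 < t)
    (hr : s + 1 ≤ r) {z : ℂ} (hz : ‖z‖ ≤ s ∨ s + 1 ≤ ‖z‖)
    (hζ : ∀ ζ : ℂ, s < ‖ζ‖ → ‖ζ‖ < s + 1 → t ≤ ‖z - ζ‖ ∧
      |n - α * ‖ζ‖ ^ 2| ≤ d * (√α * ‖ζ‖) ∧
      |((n + 3 * N : ℕ) : ℝ) - α * ‖ζ‖ ^ 2| ≤ d * (√α * ‖ζ‖) ∧ ‖ζ‖ ≤ c * N) :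
    ‖(if ‖z‖ ≤ s then f z else 0) - avgTaylor f n N z‖ₑ *
        ENNReal.ofReal (Real.exp (-α * ‖z‖ ^ 2 / 2)) ≤
      ENNReal.ofReal (16 * Real.exp (d ^ 2 / 2) * c ^ 3) *
        ∫⁻ ζ in Metric.ball 0 r, ‖weighted α f ζ‖ₑ * kernel t (z - ζ) := by
  have hA : MeasurableSet {ζ : ℂ | s < ‖ζ‖ ∧ ‖ζ‖ < s + 1} :=
    (measurableSet_lt measurable_const measurable_norm).inter
      (measurableSet_lt measurable_norm measurable_const)
  refine (mul_le_mul_left (enorm_sub_avgTaylor_le hf hs n hN hz) _).trans ?_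
  rw [← lintegral_mul_const' _ _ ENNReal.ofReal_ne_top, ← lintegral_const_mul' _ _
    ENNReal.ofReal_ne_top]
  refine (setLIntegral_mono' hA fun ζ h ↦ ?_).trans
    (lintegral_mono_set fun ζ h ↦ by simpa using h.2.trans_le hr)
  obtain ⟨h1, h2, h3, h4⟩ := hζ ζ h.1 h.2
  have hne : z ≠ ζ := fun e ↦ by simp [e] at h1; linarith
  have hζ0 : ζ ≠ 0 := fun e ↦ by simp [e] at h; linarith [h.1]
  have := norm_avgPow_div_mul_exp_le hα hN hζ0 hne h2 h3 h4
  rw [enorm_weighted, kernel, Set.indicator_of_mem (by exact h1), mul_assoc ‖f ζ‖ₑ,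
    mul_assoc ‖f ζ‖ₑ, mul_left_comm _ ‖f ζ‖ₑ, ← ofReal_norm (avgPow _ _ _ / _),
    ← ENNReal.ofReal_mul (norm_nonneg _),
    ← ENNReal.ofReal_mul (Real.exp_pos _).le, ← ENNReal.ofReal_mul (by positivity)]
  refine mul_le_mul_right (ENNReal.ofReal_le_ofReal (this.trans_eq ?_)) _
  ring

/-- The constant of the local estimates. -/
def localConst (α : ℝ) : ℝ :=
  16 * Real.exp ((8 * √α + 12) ^ 2 / 2) * ((1 + 4 * √α) / √α) ^ 3

lemma sqrt_nat_bounds (m : ℕ) :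
    √(m : ℝ) ≤ (Nat.sqrt m + 1 : ℕ) ∧ ((Nat.sqrt m + 1 : ℕ) : ℝ) ≤ √(m : ℝ) + 1 := by
  constructor
  · push_cast
    exact Real.real_sqrt_le_nat_sqrt_succ
  · push_cast
    linarith [Real.nat_sqrt_le_real_sqrt (a := m)]

/-- A window of `N = ⌊√m⌋ + 1` degrees is long enough to dominate a multiple of `ρ` and short enough
that both `m` and `m + 3N` stay within `O(ρ)` of `αρ²`. -/
lemma outer_params {α : ℝ} (hα : 0 < α) {m : ℕ} (hm : 1 ≤ m) {ρ : ℝ}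
    (h1 : √(m / α) ≤ ρ) (h2 : ρ ≤ √(m / α) + 4) :
    |m - α * ρ ^ 2| ≤ (8 * √α + 12) * (√α * ρ) ∧
    |((m + 3 * (Nat.sqrt m + 1) : ℕ) : ℝ) - α * ρ ^ 2| ≤ (8 * √α + 12) * (√α * ρ) ∧
    ρ ≤ (1 + 4 * √α) / √α * (Nat.sqrt m + 1 : ℕ) := by
  have hb : 0 < √α := Real.sqrt_pos.2 hα
  obtain ⟨hN1, hN2⟩ := sqrt_nat_bounds m
  have hNge : (1 : ℝ) ≤ (Nat.sqrt m + 1 : ℕ) := by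
    push_cast
    linarith [Nat.cast_nonneg (α := ℝ) (Nat.sqrt m)]
  rw [Real.sqrt_div' _ hα.le] at h1 h2
  have hx : √(m : ℝ) ^ 2 = m := Real.sq_sqrt (by positivity)
  have hx1 : 1 ≤ √(m : ℝ) := Real.one_le_sqrt.2 (by exact_mod_cast hm)
  have hαρ : α * ρ ^ 2 = (√α * ρ) ^ 2 := by rw [mul_pow, Real.sq_sqrt hα.le]
  rw [div_le_iff₀ hb, mul_comm] at h1
  have h2' : √α * ρ ≤ √(m : ℝ) + 4 * √α := by
    have := mul_le_mul_of_nonneg_left h2 hb.le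
    rwa [mul_add, mul_div_cancel₀ _ hb.ne', mul_comm (√α) 4] at this
  rw [Nat.cast_add, Nat.cast_mul, hαρ]
  set N : ℝ := ((Nat.sqrt m + 1 : ℕ) : ℝ)
  nth_rewrite 1 [← hx]
  nth_rewrite 2 [← hx]
  have h3 : ρ ≤ (1 + 4 * √α) / √α * N := by
    rw [div_mul_eq_mul_div, le_div_iff₀ hb]
    nlinarith
  generalize √α * ρ = y at *
  generalize √(m : ℝ) = x at *
  generalize √α = b at *
  refine ⟨?_, ?_, h3⟩
  · rw [abs_le]; constructor <;> nlinarith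
  · push_cast
    rw [abs_le]; constructor <;> nlinarith

/-- The condition `6 ≤ √m` makes `m - 3N` a genuine subtraction. The condition `2√α ≤ √m` says that
the radius is at least `2`, so that an annulus of width `1` just inside the circle keeps `ρ`
comparable with the radius. -/
lemma inner_params {α : ℝ} (hα : 0 < α) {m : ℕ} (hm : 6 ≤ √(m : ℝ)) (hm' : 2 * √α ≤ √(m : ℝ))
    {ρ : ℝ} (h1 : √(m / α) - 1 ≤ ρ) (h2 : ρ ≤ √(m / α)) :
    |((m - 3 * (Nat.sqrt m + 1) : ℕ) : ℝ) - α * ρ ^ 2| ≤ (8 * √α + 12) * (√α * ρ) ∧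
    |m - α * ρ ^ 2| ≤ (8 * √α + 12) * (√α * ρ) ∧
    ρ ≤ (1 + 4 * √α) / √α * (Nat.sqrt m + 1 : ℕ) ∧ 3 * (Nat.sqrt m + 1) ≤ m := by
  have hb : 0 < √α := Real.sqrt_pos.2 hα
  obtain ⟨hN1, hN2⟩ := sqrt_nat_bounds m
  rw [Real.sqrt_div' _ hα.le] at h1 h2
  have hx : √(m : ℝ) ^ 2 = m := Real.sq_sqrt (by positivity)
  have hαρ : α * ρ ^ 2 = (√α * ρ) ^ 2 := by rw [mul_pow, Real.sq_sqrt hα.le]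
  rw [le_div_iff₀ hb, mul_comm] at h2
  have h1' : √(m : ℝ) - √α ≤ √α * ρ := by
    have := mul_le_mul_of_nonneg_left h1 hb.le
    rwa [mul_sub, mul_div_cancel₀ _ hb.ne', mul_one] at this
  have hle : 3 * (Nat.sqrt m + 1) ≤ m := by
    have : (3 * (Nat.sqrt m + 1 : ℕ) : ℝ) ≤ m := by
      generalize ((Nat.sqrt m + 1 : ℕ) : ℝ) = N at *
      nlinarith
    exact_mod_cast this
  rw [Nat.cast_sub hle, Nat.cast_mul, hαρ]
  set N : ℝ := ((Nat.sqrt m + 1 : ℕ) : ℝ)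
  nth_rewrite 1 [← hx]
  nth_rewrite 2 [← hx]
  have h3 : ρ ≤ (1 + 4 * √α) / √α * N := by
    rw [div_mul_eq_mul_div, le_div_iff₀ hb]
    nlinarith
  generalize √α * ρ = y at *
  generalize √(m : ℝ) = x at *
  generalize √α = b at *
  refine ⟨?_, ?_, h3, hle⟩
  · push_cast
    rw [abs_le]; constructor <;> nlinarith
  · rw [abs_le]; constructor <;> nlinarith

lemma taylorPoly_eq_zero {f : ℂ → ℂ} {m n : ℕ} (hf : ∀ k < m, iteratedDeriv k f 0 = 0)
    (hn : n ≤ m) (z : ℂ) : taylorPoly f n z = 0 :=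
  sum_eq_zero fun k hk ↦ by rw [hf k ((mem_range.1 hk).trans_le hn)]; simp

/-- The window starts at `m - 3N`, so every averaged Taylor polynomial has degree less than `m` and
vanishes. What remains is `f` as an integral over the last unit annulus inside the circle, at
distance at least `t` from `z`. -/
lemma inner_estimate_zero {α : ℝ} (hα : 0 < α) {m : ℕ} (hm : 6 ≤ √(m : ℝ))
    (hm' : 2 * √α ≤ √(m : ℝ)) {f : ℂ → ℂ} (hf : Differentiable ℂ f)
    (hf0 : ∀ k < m, iteratedDeriv k f 0 = 0) {t : ℝ} (ht : 0 < t) {z : ℂ}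
    (hz : ‖z‖ + t + 1 ≤ √(m / α)) :
    ‖weighted α f z‖ₑ ≤ ENNReal.ofReal (localConst α) *
      ∫⁻ ζ in Metric.ball 0 √(m / α), ‖weighted α f ζ‖ₑ * kernel t (z - ζ) := by
  have hs : ‖z‖ ≤ √(m / α) - 1 := by linarith
  have hs0 := (norm_nonneg z).trans hs
  obtain ⟨-, -, -, hle⟩ := inner_params hα hm hm' (ρ := √(m / α)) (by linarith) le_rfl
  have key := enorm_sub_avgTaylor_weighted_le hα (c := (1 + 4 * √α) / √α)
    (d := 8 * √α + 12) (by positivity) (n := m - 3 * (Nat.sqrt m + 1)) (Nat.sqrt m).succ_ne_zero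
    hf hs0 ht (r := √(m / α)) (by linarith) (Or.inl hs) fun ζ h1 h2 ↦ by
      obtain ⟨a1, a2, a3, -⟩ := inner_params hα hm hm' (ρ := ‖ζ‖) h1.le (by linarith)
      refine ⟨?_, a1, ?_, a3⟩
      · rw [norm_sub_rev]
        linarith [norm_sub_norm_le ζ z]
      · rwa [Nat.sub_add_cancel hle]
  have hz0 : avgTaylor f (m - 3 * (Nat.sqrt m + 1)) (Nat.sqrt m + 1) z = 0 := by
    rw [avgTaylor, sum_eq_zero, mul_zero]
    refine fun i hi ↦ sum_eq_zero fun j hj ↦ sum_eq_zero fun k hk ↦ taylorPoly_eq_zero hf0 ?_ z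
    rw [mem_range] at hi hj hk
    omega
  rw [enorm_weighted]
  simpa only [if_pos hs, Nat.succ_eq_add_one, hz0, sub_zero, localConst] using key

lemma outer_estimate_zero {α : ℝ} (hα : 0 < α) {m : ℕ} (hm : 1 ≤ m)
    {f : ℂ → ℂ} (hf : Differentiable ℂ f) (z : ℂ) :
    ‖weighted α (avgTaylor f m (Nat.sqrt m + 1)) z‖ₑ ≤
      (Metric.ball 0 (√(m / α) + 4)).indicator (fun z ↦ ‖weighted α f z‖ₑ) z +
      ENNReal.ofReal (localConst α) *
      ∫⁻ ζ in Metric.ball 0 (√(m / α) + 4), ‖weighted α f ζ‖ₑ * kernel 1 (z - ζ) := by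
  have hR : 0 ≤ √(m / α) := Real.sqrt_nonneg _
  have hc : 0 ≤ (1 + 4 * √α) / √α := by positivity
  -- The annulus of integration is chosen at distance at least `1` from `z`: beyond `√(m/α) + 3` for
  -- the near points, where `f z` itself appears, and just outside `√(m/α)` for the far points,
  -- where it does not.
  rcases le_or_gt ‖z‖ (√(m / α) + 2) with h | h
  · have hs : ‖z‖ ≤ √(m / α) + 3 := by linarith
    have key := enorm_sub_avgTaylor_weighted_le hα hc
      (d := 8 * √α + 12) (n := m) (Nat.sqrt m).succ_ne_zero
      hf (s := √(m / α) + 3) (by linarith) one_pos (r := √(m / α) + 4) (by linarith) (Or.inl hs)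
      fun ζ h1 h2 ↦ by
        obtain ⟨a1, a2, a3⟩ := outer_params hα hm (ρ := ‖ζ‖) (by linarith) (by linarith)
        refine ⟨?_, a1, a2, a3⟩
        rw [norm_sub_rev]
        linarith [norm_sub_norm_le ζ z]
    rw [Set.indicator_of_mem (by rw [mem_ball_zero_iff]; linarith), enorm_weighted, enorm_weighted]
    refine le_trans ?_ (add_le_add_right key _)
    rw [← add_mul, if_pos hs]
    gcongr
    set g := avgTaylor f m (Nat.sqrt m + 1) z
    calc ‖g‖ₑ = ‖f z - (f z - g)‖ₑ := by congr 1; ring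
      _ ≤ _ := enorm_sub_le
  · have key := enorm_sub_avgTaylor_weighted_le hα hc
      (d := 8 * √α + 12) (n := m) (Nat.sqrt m).succ_ne_zero
      hf (s := √(m / α)) hR one_pos (r := √(m / α) + 4) (z := z) (by linarith)
      (Or.inr (by linarith))
      fun ζ h1 h2 ↦ by
        obtain ⟨a1, a2, a3⟩ := outer_params hα hm (ρ := ‖ζ‖) (by linarith) (by linarith)
        refine ⟨?_, a1, a2, a3⟩
        linarith [norm_sub_norm_le z ζ]
    rw [if_neg (by linarith), zero_sub, enorm_neg, ← enorm_weighted] at key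
    exact key.trans le_add_self

/-- The Fock space translation `f(w + l) exp(-α l̄ w - α |l|² / 2)`. -/
def transl (α : ℝ) (l : ℂ) (f : ℂ → ℂ) (w : ℂ) : ℂ :=
  f (w + l) * Complex.exp (-α * (starRingEnd ℂ l * w) - α * (‖l‖ ^ 2 : ℝ) / 2)

lemma transl_differentiable {α : ℝ} {l : ℂ} {f : ℂ → ℂ} (hf : Differentiable ℂ f) :
    Differentiable ℂ (transl α l f) := by
  unfold transl
  fun_prop

/-- The exponential factor supplies the cross term of `|w + l|² = |w|² + 2 Re(l̄ w) + |l|²`. Hence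
translations are isometries and the estimates at the origin hold at every point. -/
lemma enorm_weighted_transl (α : ℝ) (l : ℂ) (f : ℂ → ℂ) (w : ℂ) :
    ‖weighted α (transl α l f) w‖ₑ = ‖weighted α f (w + l)‖ₑ := by
  rw [enorm_weighted, enorm_weighted, transl, enorm_mul, mul_assoc]
  congr 1
  rw [← ofReal_norm (Complex.exp _), Complex.norm_exp, ← ENNReal.ofReal_mul (Real.exp_pos _).le,
    ← Real.exp_add]
  congr 2
  rw [← Complex.normSq_eq_norm_sq w, ← Complex.normSq_eq_norm_sq (w + l),
    ← Complex.normSq_eq_norm_sq l]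
  simp [Complex.normSq_apply]
  ring

lemma transl_neg_transl (α : ℝ) (l : ℂ) (f : ℂ → ℂ) : transl α (-l) (transl α l f) = f := by
  ext w
  rw [transl, transl, mul_assoc, ← Complex.exp_add, neg_add_cancel_right]
  have : (starRingEnd ℂ l) * l = (‖l‖ ^ 2 : ℝ) := by
    rw [mul_comm, Complex.mul_conj, Complex.normSq_eq_norm_sq]
  rw [show -(α : ℂ) * (starRingEnd ℂ l * (w + -l)) - α * (‖l‖ ^ 2 : ℝ) / 2 +
    (-α * (starRingEnd ℂ (-l) * w) - α * (‖-l‖ ^ 2 : ℝ) / 2) = 0 by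
      rw [norm_neg, map_neg, mul_add, mul_neg, this]; ring, Complex.exp_zero, mul_one]

/-- Orders of vanishing add under multiplication, which avoids the Leibniz formula. -/
lemma iteratedDeriv_mul_eq_zero {f e : ℂ → ℂ} (hf : Differentiable ℂ f) (he : Differentiable ℂ e)
    {l : ℂ} {m : ℕ} (h : ∀ k < m, iteratedDeriv k f l = 0) :
    ∀ k < m, iteratedDeriv k (fun z ↦ f z * e z) l = 0 := by
  rw [← natCast_le_analyticOrderAt_iff_iteratedDeriv_eq_zero (hf.analyticAt l)] at h
  change ∀ k < m, iteratedDeriv k (f * e) l = 0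
  rw [← natCast_le_analyticOrderAt_iff_iteratedDeriv_eq_zero ((hf.mul he).analyticAt l)]
  have := analyticOrderAt_mul (hf.analyticAt l) (he.analyticAt l)
  rw [this]
  exact h.trans le_self_add

lemma iteratedDeriv_transl_eq_zero {α : ℝ} {l : ℂ} {f : ℂ → ℂ} (hf : Differentiable ℂ f)
    {w : ℂ} {m : ℕ} (h : ∀ k < m, iteratedDeriv k f (w + l) = 0) :
    ∀ k < m, iteratedDeriv k (transl α l f) w = 0 := by
  refine iteratedDeriv_mul_eq_zero (f := fun w ↦ f (w + l)) (by fun_prop) (by fun_prop) ?_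
  intro k hk
  rw [iteratedDeriv_comp_add_const]
  exact h k hk

lemma iteratedDeriv_taylorPoly {f : ℂ → ℂ} {k n : ℕ} (hk : k < n) :
    iteratedDeriv k (taylorPoly f n) 0 = iteratedDeriv k f 0 := by
  unfold taylorPoly
  rw [iteratedDeriv_fun_sum fun i _ ↦ by fun_prop]
  rw [sum_eq_single k]
  · rw [iteratedDeriv_const_mul_field]
    have : (k.factorial : ℂ) ≠ 0 := by exact_mod_cast k.factorial_ne_zero
    simp [Nat.descFactorial_self]
    field_simp
  · intro j _ hj
    rw [iteratedDeriv_const_mul_field]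
    rcases lt_or_gt_of_ne hj with h | h
    · simp [iteratedDeriv_eq_iterate, Nat.descFactorial_of_lt h]
    · simp [iteratedDeriv_eq_iterate, Nat.sub_ne_zero_of_lt h]
  · intro h; exact absurd (mem_range.2 hk) h

lemma taylorPoly_differentiable (f : ℂ → ℂ) (n : ℕ) : Differentiable ℂ (taylorPoly f n) := by
  unfold taylorPoly
  fun_prop

lemma avgTaylor_differentiable (f : ℂ → ℂ) (n N : ℕ) : Differentiable ℂ (avgTaylor f n N) := by
  have := taylorPoly_differentiable f
  unfold avgTaylor
  fun_prop

lemma iteratedDeriv_sum_range_eq {k N : ℕ} {g : ℕ → ℂ → ℂ} {c : ℂ}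
    (hg : ∀ i, Differentiable ℂ (g i)) (hc : ∀ i, iteratedDeriv k (g i) 0 = c) :
    iteratedDeriv k (fun z ↦ ∑ i ∈ range N, g i z) 0 = N * c := by
  rw [iteratedDeriv_fun_sum fun i _ ↦ (hg i).contDiff.contDiffAt]
  simp [hc]

lemma iteratedDeriv_avgTaylor {f : ℂ → ℂ} {k n N : ℕ} (hk : k < n) (hN : N ≠ 0) :
    iteratedDeriv k (avgTaylor f n N) 0 = iteratedDeriv k f 0 := by
  have hd := taylorPoly_differentiable f
  unfold avgTaylor
  rw [iteratedDeriv_const_mul_field, iteratedDeriv_sum_range_eq (fun i ↦ by fun_prop) fun i ↦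
    iteratedDeriv_sum_range_eq (fun j ↦ by fun_prop) fun j ↦
    iteratedDeriv_sum_range_eq (fun l ↦ by fun_prop) fun l ↦
    iteratedDeriv_taylorPoly (f := f) (show k < n + i + j + l by omega)]
  have : (N : ℂ) ≠ 0 := by exact_mod_cast hN
  field_simp

end LocalAtOrigin

/-! ### Local estimates in `L^p` and for quotient norms. -/

section LocalEstimates

open MeasureTheory

lemma setLIntegral_ball_add (F : ℂ → ℝ≥0∞) (l : ℂ) (r : ℝ) :
    ∫⁻ ζ in Metric.ball 0 r, F (ζ + l) = ∫⁻ ζ in Metric.ball l r, F ζ := by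
  rw [← lintegral_indicator Metric.isOpen_ball.measurableSet,
    ← lintegral_indicator Metric.isOpen_ball.measurableSet,
    ← lintegral_add_right_eq_self ((Metric.ball l r).indicator fun ζ ↦ F ζ) l]
  refine lintegral_congr fun ζ ↦ ?_
  simp [Set.indicator, dist_eq_norm]

/-- A function vanishing at `l` to order `m` is controlled, well inside `D(l, √(m/α))`, by its
values on this disc. -/
lemma inner_estimate {α : ℝ} (hα : 0 < α) {m : ℕ} (hm : 6 ≤ √(m : ℝ))
    (hm' : 2 * √α ≤ √(m : ℝ)) {f : ℂ → ℂ} (hf : Differentiable ℂ f) {l : ℂ}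
    (hf0 : ∀ k < m, iteratedDeriv k f l = 0) {t : ℝ} (ht : 0 < t) {z : ℂ}
    (hz : ‖z - l‖ + t + 1 ≤ √(m / α)) :
    ‖weighted α f z‖ₑ ≤ ENNReal.ofReal (localConst α) *
      ∫⁻ ζ in Metric.ball l √(m / α), ‖weighted α f ζ‖ₑ * kernel t (z - ζ) := by
  have := inner_estimate_zero hα hm hm' (transl_differentiable (α := α) (l := l) hf)
    (iteratedDeriv_transl_eq_zero hf (by simpa using hf0)) ht hz
  rw [enorm_weighted_transl, sub_add_cancel] at this
  refine this.trans_eq ?_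
  rw [← setLIntegral_ball_add _ l]
  simp_rw [enorm_weighted_transl, sub_sub, add_comm l]

/-- A function has the same `m`-jet at `l` as a function controlled by its values
in a neighbourhood of `D(l, √(m/α))`. -/
lemma outer_estimate {α : ℝ} (hα : 0 < α) {m : ℕ} (hm : 1 ≤ m)
    {f : ℂ → ℂ} (hf : Differentiable ℂ f) (l : ℂ) :
    ∃ g : ℂ → ℂ, Differentiable ℂ g ∧ (∀ k < m, iteratedDeriv k (f - g) l = 0) ∧
    ∀ z, ‖weighted α g z‖ₑ ≤
      (Metric.ball l (√(m / α) + 4)).indicator (fun z ↦ ‖weighted α f z‖ₑ) z +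
      ENNReal.ofReal (localConst α) *
      ∫⁻ ζ in Metric.ball l (√(m / α) + 4), ‖weighted α f ζ‖ₑ * kernel 1 (z - ζ) := by
  have hF := transl_differentiable (α := α) (l := l) hf
  set F := transl α l f
  set G := avgTaylor F m (Nat.sqrt m + 1)
  have hG : Differentiable ℂ G := avgTaylor_differentiable _ _ _
  refine ⟨transl α (-l) G, transl_differentiable hG, ?_, fun z ↦ ?_⟩
  · have : f - transl α (-l) G = transl α (-l) (F - G) := by
      conv_lhs => rw [← transl_neg_transl α l f]
      ext w
      simp [transl, sub_mul, F]
    rw [this]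
    refine iteratedDeriv_transl_eq_zero (hF.sub hG) fun k hk ↦ ?_
    rw [add_neg_cancel, iteratedDeriv_sub hF.contDiff.contDiffAt hG.contDiff.contDiffAt,
      iteratedDeriv_avgTaylor hk (Nat.succ_ne_zero _), sub_self]
  · rw [enorm_weighted_transl]
    refine (outer_estimate_zero hα hm hF (z + -l)).trans_eq ?_
    rw [← setLIntegral_ball_add _ l]
    simp_rw [F, enorm_weighted_transl, ← sub_eq_add_neg, sub_sub, add_comm l]
    congr 1
    simp [Set.indicator, dist_eq_norm]

/-- Young's inequality: Hölder with `k = k^(1/p) k^(1/q)`, then Tonelli. -/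
lemma lintegral_convolution_rpow_le {p : ℝ} (hp : 1 < p) {u k : ℂ → ℝ≥0∞} (hu : Measurable u)
    (hk : Measurable k) :
    ∫⁻ z, (∫⁻ ζ, u ζ * k (z - ζ)) ^ p ≤ (∫⁻ z, k z) ^ p * ∫⁻ z, u z ^ p := by
  have hp0 : 0 < p := by linarith
  have hpq := Real.HolderConjugate.conjExponent hp
  set q := p.conjExponent
  have hq0 : 0 < q := hpq.symm.pos
  have e1 : p⁻¹ + q⁻¹ = 1 := hpq.inv_add_inv_eq_one
  have key (z : ℂ) : (∫⁻ ζ, u ζ * k (z - ζ)) ^ p ≤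
      (∫⁻ z, k z) ^ (p - 1) * ∫⁻ ζ, u ζ ^ p * k (z - ζ) := by
    have hk' : Measurable fun ζ ↦ k (z - ζ) := hk.comp (measurable_const.sub measurable_id)
    have h := ENNReal.lintegral_mul_le_Lp_mul_Lq volume hpq
      (f := fun ζ ↦ u ζ * k (z - ζ) ^ p⁻¹) (g := fun ζ ↦ k (z - ζ) ^ q⁻¹)
      (by fun_prop) (by fun_prop)
    have a1 : ∀ ζ, ((fun ζ ↦ u ζ * k (z - ζ) ^ p⁻¹) * fun ζ ↦ k (z - ζ) ^ q⁻¹) ζ =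
        u ζ * k (z - ζ) := fun ζ ↦ by
      simp only [Pi.mul_apply]
      rw [mul_assoc, ← ENNReal.rpow_add_of_nonneg _ _ (by positivity) (by positivity), e1,
        ENNReal.rpow_one]
    have a2 : ∀ ζ, (u ζ * k (z - ζ) ^ p⁻¹) ^ p = u ζ ^ p * k (z - ζ) := fun ζ ↦ by
      rw [ENNReal.mul_rpow_of_nonneg _ _ hp0.le, ← ENNReal.rpow_mul, inv_mul_cancel₀ hp0.ne',
        ENNReal.rpow_one]
    have a3 : ∀ ζ, (k (z - ζ) ^ q⁻¹) ^ q = k (z - ζ) := fun ζ ↦ by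
      rw [← ENNReal.rpow_mul, inv_mul_cancel₀ hq0.ne', ENNReal.rpow_one]
    simp_rw [a1, a2, a3] at h
    rw [lintegral_sub_left_eq_self k z] at h
    refine (ENNReal.rpow_le_rpow h hp0.le).trans_eq ?_
    rw [ENNReal.mul_rpow_of_nonneg _ _ hp0.le, ← ENNReal.rpow_mul, ← ENNReal.rpow_mul,
      one_div_mul_cancel hp0.ne', ENNReal.rpow_one, mul_comm]
    congr 2
    have : q⁻¹ = 1 - p⁻¹ := by linarith
    rw [one_div, this, sub_mul, inv_mul_cancel₀ hp0.ne', one_mul]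
  calc _ ≤ ∫⁻ z, (∫⁻ z, k z) ^ (p - 1) * ∫⁻ ζ, u ζ ^ p * k (z - ζ) := lintegral_mono key
    _ = (∫⁻ z, k z) ^ (p - 1) * ∫⁻ ζ, u ζ ^ p * ∫⁻ z, k z := by
      have hm : Measurable fun x : ℂ × ℂ ↦ u x.2 ^ p * k (x.1 - x.2) :=
        ((hu.comp measurable_snd).pow_const p).mul (hk.comp (measurable_fst.sub measurable_snd))
      rw [lintegral_const_mul _ hm.lintegral_prod_right', lintegral_lintegral_swap hm.aemeasurable]
      congr 1
      refine lintegral_congr fun ζ ↦ ?_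
      have hk' : Measurable fun z ↦ k (z - ζ) := hk.comp (measurable_id.sub measurable_const)
      simp only
      rw [lintegral_const_mul _ hk']
      congr 1
      exact lintegral_sub_right_eq_self k ζ
    _ = _ := by
      rw [lintegral_mul_const _ (hu.pow_const p), mul_comm (∫⁻ ζ, u ζ ^ p), ← mul_assoc]
      congr 1
      nth_rewrite 2 [← ENNReal.rpow_one (∫⁻ z, k z)]
      rw [← ENNReal.rpow_add_of_nonneg _ _ (by linarith) zero_le_one, sub_add_cancel]

/-- The kernel `|w|⁻⁴ (1 + |w|)`, restricted to `|w| ≥ t`. -/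
def kernel' (t : ℝ) (w : ℂ) : ℝ≥0∞ := kernel t w * ENNReal.ofReal (1 + ‖w‖)

lemma measurable_kernel' (t : ℝ) : Measurable (kernel' t) :=
  (measurable_kernel t).mul (by fun_prop)

lemma kernel_le_kernel' (t : ℝ) (w : ℂ) : kernel t w ≤ kernel' t w :=
  le_mul_of_one_le_right' (by
    rw [← ENNReal.ofReal_one]
    exact ENNReal.ofReal_le_ofReal (by linarith [norm_nonneg w]))

lemma lintegral_kernel'_one : ∫⁻ w, kernel' 1 w < ∞ := by
  have h : ∫⁻ w : ℂ, ENNReal.ofReal ((1 + ‖w‖) ^ (-(3 : ℝ))) < ∞ :=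
    finite_integral_one_add_norm (by rw [Complex.finrank_real_complex]; norm_num)
  have : ∀ w : ℂ, kernel' 1 w ≤ 16 * ENNReal.ofReal ((1 + ‖w‖) ^ (-(3 : ℝ))) := fun w ↦ by
    rw [kernel', kernel, Set.indicator]
    split_ifs with hw
    · replace hw : 1 ≤ ‖w‖ := hw
      rw [show (16 : ℝ≥0∞) = ENNReal.ofReal 16 by simp, ← ENNReal.ofReal_mul (by positivity),
        ← ENNReal.ofReal_mul (by positivity)]
      refine ENNReal.ofReal_le_ofReal ?_
      rw [Real.rpow_neg (by positivity), show (3 : ℝ) = (3 : ℕ) by norm_num, Real.rpow_natCast]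
      generalize ‖w‖ = r at *
      have h1 : (1 + r) ^ 4 ≤ (2 * r) ^ 4 := by gcongr; linarith
      have : 0 < r := by linarith
      rw [← div_eq_inv_mul, ← div_eq_mul_inv, div_le_div_iff₀ (by positivity) (by positivity)]
      nlinarith
    · simp
  refine (lintegral_mono this).trans_lt ?_
  rw [lintegral_const_mul' _ _ (by simp)]
  exact ENNReal.mul_lt_top (by simp) h

lemma kernel'_anti {s t : ℝ} (h : s ≤ t) (w : ℂ) : kernel' t w ≤ kernel' s w := by
  unfold kernel' kernel
  gcongr

lemma kernel'_eq_zero {t : ℝ} {w : ℂ} (h : ‖w‖ < t) : kernel' t w = 0 := by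
  unfold kernel' kernel
  rw [Set.indicator_of_notMem (by simpa using h), zero_mul]

/-- The source of all smallness in the inner estimates: the tails of an integrable kernel. -/
lemma tendsto_lintegral_kernel' :
    Filter.Tendsto (fun t ↦ ∫⁻ w, kernel' t w) Filter.atTop (nhds 0) := by
  have := tendsto_lintegral_filter_of_dominated_convergence (μ := (volume : Measure ℂ))
    (l := Filter.atTop) (F := fun t w ↦ kernel' t w) (f := fun _ ↦ 0) (kernel' 1)
    (Filter.Eventually.of_forall measurable_kernel')
    ((Filter.eventually_ge_atTop 1).mono fun t ht ↦ Filter.Eventually.of_forall fun w ↦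
      kernel'_anti ht w) lintegral_kernel'_one.ne
    (Filter.Eventually.of_forall fun w ↦ tendsto_const_nhds.congr' <|
      (Filter.eventually_gt_atTop ‖w‖).mono fun t ht ↦ (kernel'_eq_zero ht).symm)
  simpa using this

lemma measurable_weighted {f : ℂ → ℂ} (α : ℝ) (hf : Continuous f) :
    Measurable fun z ↦ ‖weighted α f z‖ₑ := by
  have : Continuous (weighted α f) := by
    unfold weighted
    fun_prop
  exact this.measurable.enorm

lemma norm_rpow {p : ℝ} (hp : 0 < p) (α : ℝ) (f : ℂ → ℂ) :
    norm α p f ^ p = ∫⁻ z, ‖weighted α f z‖ₑ ^ p := by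
  rw [norm, eLpNorm_eq_lintegral_rpow_enorm_toReal (by simpa using hp) ENNReal.ofReal_ne_top,
    ENNReal.toReal_ofReal hp.le, ← ENNReal.rpow_mul, one_div_mul_cancel hp.ne', ENNReal.rpow_one]

lemma mem_space_iff {α p : ℝ} (hp : 0 < p) {f : ℂ → ℂ} :
    f ∈ space α p ↔ Differentiable ℂ f ∧ ∫⁻ z, ‖weighted α f z‖ₑ ^ p < ∞ := by
  refine and_congr_right fun hf ↦ ?_
  have hc : Continuous (weighted α f) := by
    have := hf.continuous
    unfold weighted
    fun_prop
  rw [MemLp, and_iff_right hc.aestronglyMeasurable, ← norm_rpow hp, norm,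
    ENNReal.rpow_lt_top_iff_of_pos hp]

lemma weighted_add (α : ℝ) (f g : ℂ → ℂ) (z : ℂ) :
    weighted α (f + g) z = weighted α f z + weighted α g z := by
  simp [weighted, add_mul]

lemma weighted_sub (α : ℝ) (f g : ℂ → ℂ) (z : ℂ) :
    weighted α (f - g) z = weighted α f z - weighted α g z := by
  simp [weighted, sub_mul]

lemma sub_mem_space {α p : ℝ} {f g : ℂ → ℂ} (hf : f ∈ space α p) (hg : g ∈ space α p) :
    f - g ∈ space α p := by
  refine ⟨hf.1.sub hg.1, ?_⟩
  have : weighted α (f - g) = weighted α f - weighted α g := funext (weighted_sub α f g)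
  rw [this]
  exact hf.2.sub hg.2

lemma add_mem_space {α p : ℝ} {f g : ℂ → ℂ} (hf : f ∈ space α p) (hg : g ∈ space α p) :
    f + g ∈ space α p := by
  refine ⟨hf.1.add hg.1, ?_⟩
  have : weighted α (f + g) = weighted α f + weighted α g := funext (weighted_add α f g)
  rw [this]
  exact hf.2.add hg.2

lemma setLIntegral_weighted_add_le {α p : ℝ} (hp : 1 ≤ p) {f g : ℂ → ℂ} (hf : Continuous f)
    (E : Set ℂ) :
    ∫⁻ z in E, ‖weighted α (f + g) z‖ₑ ^ p ≤ 2 ^ (p - 1) *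
      ((∫⁻ z in E, ‖weighted α f z‖ₑ ^ p) + ∫⁻ z in E, ‖weighted α g z‖ₑ ^ p) := by
  have hm := (measurable_weighted α hf).pow_const p
  rw [← lintegral_add_left hm, ← lintegral_const_mul' _ _ (by simp)]
  refine lintegral_mono fun z ↦ ?_
  refine le_trans ?_ (ENNReal.rpow_add_le_mul_rpow_add_rpow _ _ hp)
  gcongr
  rw [weighted_add]
  exact enorm_add_le _ _

/-- The constant of the outer estimate in `L^p`. -/
def outerConst (α p : ℝ) : ℝ≥0∞ :=
  2 ^ (p - 1) * (1 + (ENNReal.ofReal (localConst α) * ∫⁻ w, kernel' 1 w) ^ p)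

lemma outerConst_lt_top (α : ℝ) {p : ℝ} (hp : 1 < p) : outerConst α p < ∞ := by
  have h := lintegral_kernel'_one
  have h1 : (2 : ℝ≥0∞) ^ (p - 1) < ∞ := ENNReal.rpow_lt_top_of_nonneg (by linarith) (by simp)
  have h2 : (ENNReal.ofReal (localConst α) * ∫⁻ w, kernel' 1 w) ^ p < ∞ :=
    ENNReal.rpow_lt_top_of_nonneg (by linarith) (ENNReal.mul_lt_top ENNReal.ofReal_lt_top h).ne
  exact ENNReal.mul_lt_top h1 (ENNReal.add_lt_top.2 ⟨by simp, h2⟩)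

lemma lintegral_setConvolution_rpow_le {p : ℝ} (hp : 1 < p) {u : ℂ → ℝ≥0∞} (hu : Measurable u)
    {k : ℂ → ℝ≥0∞} (hk : Measurable k) {E : Set ℂ} (hE : MeasurableSet E) (c : ℝ≥0∞) :
    ∫⁻ z, (c * ∫⁻ ζ in E, u ζ * k (z - ζ)) ^ p ≤
      (c * ∫⁻ w, k w) ^ p * ∫⁻ z in E, u z ^ p := by
  have hp0 : 0 < p := by linarith
  have hm : Measurable fun x : ℂ × ℂ ↦ (E.indicator u) x.2 * k (x.1 - x.2) :=
    ((hu.indicator hE).comp measurable_snd).mul (hk.comp (measurable_fst.sub measurable_snd))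
  have h := lintegral_convolution_rpow_le hp (hu.indicator hE) hk
  have e1 : ∀ z, ∫⁻ ζ in E, u ζ * k (z - ζ) = ∫⁻ ζ, E.indicator u ζ * k (z - ζ) := fun z ↦ by
    rw [← lintegral_indicator hE]
    refine lintegral_congr fun ζ ↦ ?_
    by_cases hζ : ζ ∈ E <;> simp [hζ]
  have e2 : ∫⁻ z in E, u z ^ p = ∫⁻ z, E.indicator u z ^ p := by
    rw [← lintegral_indicator hE]
    refine lintegral_congr fun ζ ↦ ?_
    by_cases hζ : ζ ∈ E <;> simp [hζ, hp0]
  simp_rw [e1, e2, ENNReal.mul_rpow_of_nonneg _ _ hp0.le]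
  rw [lintegral_const_mul _ (hm.lintegral_prod_right'.pow_const p), mul_assoc]
  gcongr

lemma zero_mem_space (α p : ℝ) : (0 : ℂ → ℂ) ∈ space α p := by
  refine ⟨differentiable_const 0, ?_⟩
  have : weighted α 0 = 0 := by ext; simp [weighted]
  rw [this]
  exact MemLp.zero

/-- The function `g` of `outer_estimate` has the same jet as `f`, so `f - g` is admissible in the
infimum and the quotient norm is at most the norm of `g`. -/
lemma quotientNorm_rpow_le {α p : ℝ} (hα : 0 < α) (hp : 1 < p) {f : ℂ → ℂ} (hf : f ∈ space α p)
    (l : ℂ) {m : ℕ} (hm : 1 ≤ m) :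
    quotientNorm α p l m f ^ p ≤
      outerConst α p * ∫⁻ z in Metric.ball l (√(m / α) + 4), ‖weighted α f z‖ₑ ^ p := by
  have hp0 : 0 < p := by linarith
  obtain ⟨g, hg, hfg, hb⟩ := outer_estimate hα hm hf.1 l
  have hfm := measurable_weighted α hf.1.continuous
  set E := Metric.ball l (√(m / α) + 4)
  have hE : MeasurableSet E := Metric.isOpen_ball.measurableSet
  have hG : ∫⁻ z, ‖weighted α g z‖ₑ ^ p ≤
      outerConst α p * ∫⁻ z in E, ‖weighted α f z‖ₑ ^ p := by
    calc _ ≤ ∫⁻ z, 2 ^ (p - 1) * ((E.indicator (fun z ↦ ‖weighted α f z‖ₑ) z) ^ p +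
          (ENNReal.ofReal (localConst α) *
            ∫⁻ ζ in E, ‖weighted α f ζ‖ₑ * kernel 1 (z - ζ)) ^ p) :=
          lintegral_mono fun z ↦ (ENNReal.rpow_le_rpow (hb z) hp0.le).trans
            (ENNReal.rpow_add_le_mul_rpow_add_rpow _ _ hp.le)
      _ = 2 ^ (p - 1) * ((∫⁻ z, (E.indicator (fun z ↦ ‖weighted α f z‖ₑ) z) ^ p) +
          ∫⁻ z, (ENNReal.ofReal (localConst α) *
            ∫⁻ ζ in E, ‖weighted α f ζ‖ₑ * kernel 1 (z - ζ)) ^ p) := by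
          rw [lintegral_const_mul' _ _ (by simp),
            lintegral_add_left ((hfm.indicator hE).pow_const p)]
      _ ≤ 2 ^ (p - 1) * ((∫⁻ z in E, ‖weighted α f z‖ₑ ^ p) +
          (ENNReal.ofReal (localConst α) * ∫⁻ w, kernel 1 w) ^ p *
            ∫⁻ z in E, ‖weighted α f z‖ₑ ^ p) := by
          refine mul_le_mul_right (add_le_add ?_ ?_) _
          · rw [← lintegral_indicator hE]
            refine lintegral_mono fun ζ ↦ ?_
            by_cases hζ : ζ ∈ E <;> simp [hζ, hp0]
          · exact lintegral_setConvolution_rpow_le hp hfm (measurable_kernel 1) hE _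
      _ ≤ 2 ^ (p - 1) * ((∫⁻ z in E, ‖weighted α f z‖ₑ ^ p) +
          (ENNReal.ofReal (localConst α) * ∫⁻ w, kernel' 1 w) ^ p *
            ∫⁻ z in E, ‖weighted α f z‖ₑ ^ p) := by
          gcongr with w
          exact kernel_le_kernel' 1 w
      _ = _ := by rw [outerConst]; ring
  have hgs : g ∈ space α p := (mem_space_iff hp0).2 ⟨hg, hG.trans_lt (ENNReal.mul_lt_top
    (outerConst_lt_top α hp) ((setLIntegral_le_lintegral _ _).trans_lt
      ((mem_space_iff hp0).1 hf).2))⟩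
  refine le_trans (ENNReal.rpow_le_rpow ?_ hp0.le) ((norm_rpow hp0 α g).trans_le hG)
  refine (iInf₂_le (f - g) ⟨sub_mem_space hf hgs, hfg⟩).trans_eq ?_
  rw [sub_sub_cancel]

/-- The small constant of the inner estimate in `L^p`. -/
def innerConst (α p t : ℝ) : ℝ≥0∞ :=
  (ENNReal.ofReal (localConst α) * ∫⁻ w, kernel' t w) ^ p

lemma tendsto_innerConst (α : ℝ) {p : ℝ} (hp : 0 < p) :
    Filter.Tendsto (innerConst α p) Filter.atTop (nhds 0) := by
  have h := ENNReal.Tendsto.const_mul (a := ENNReal.ofReal (localConst α))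
    tendsto_lintegral_kernel' (Or.inr ENNReal.ofReal_ne_top)
  have := (ENNReal.continuous_rpow_const (y := p)).tendsto _ |>.comp h
  rw [mul_zero, ENNReal.zero_rpow_of_pos hp] at this
  exact this

/-- Weighted `L^p` version of `inner_estimate`. -/
lemma setLIntegral_inner_le {α p : ℝ} (hα : 0 < α) (hp : 1 < p) {m : ℕ} (hm : 6 ≤ √(m : ℝ))
    (hm' : 2 * √α ≤ √(m : ℝ)) {f : ℂ → ℂ} (hf : Differentiable ℂ f) {l : ℂ}
    (hf0 : ∀ k < m, iteratedDeriv k f l = 0) {t : ℝ} (ht : 0 < t) {ω : ℂ → ℝ≥0∞}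
    (hω : Measurable ω) (hω' : ∀ z ζ, ω z ≤ ω ζ * ENNReal.ofReal (1 + ‖z - ζ‖)) :
    ∫⁻ z in Metric.ball l (√(m / α) - (t + 1)), (ω z * ‖weighted α f z‖ₑ) ^ p ≤
      innerConst α p t * ∫⁻ z in Metric.ball l √(m / α), (ω z * ‖weighted α f z‖ₑ) ^ p := by
  have hfm := measurable_weighted α hf.continuous
  have key : ∀ z ∈ Metric.ball l (√(m / α) - (t + 1)), ω z * ‖weighted α f z‖ₑ ≤
      ENNReal.ofReal (localConst α) *
        ∫⁻ ζ in Metric.ball l √(m / α), (ω ζ * ‖weighted α f ζ‖ₑ) * kernel' t (z - ζ) := by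
    intro z hz
    rw [Metric.mem_ball, dist_eq_norm] at hz
    calc _ ≤ ω z * (ENNReal.ofReal (localConst α) *
          ∫⁻ ζ in Metric.ball l √(m / α), ‖weighted α f ζ‖ₑ * kernel t (z - ζ)) := by
          gcongr
          exact inner_estimate hα hm hm' hf hf0 ht (by linarith)
      _ = ENNReal.ofReal (localConst α) *
          ∫⁻ ζ in Metric.ball l √(m / α), ω z * (‖weighted α f ζ‖ₑ * kernel t (z - ζ)) := by
          have hm : Measurable fun ζ ↦ ‖weighted α f ζ‖ₑ * kernel t (z - ζ) :=
            hfm.mul ((measurable_kernel t).comp (measurable_const.sub measurable_id))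
          rw [lintegral_const_mul _ hm, mul_left_comm]
      _ ≤ _ := by
          refine mul_le_mul_right (lintegral_mono fun ζ ↦ ?_) _
          -- Moving the weight from `z` to `ζ` costs the factor `1 + |z - ζ|`, which is built into
          -- `kernel'`.
          refine (mul_le_mul_left (hω' z ζ) _).trans_eq ?_
          rw [kernel']; ring
  calc _ ≤ ∫⁻ z in Metric.ball l (√(m / α) - (t + 1)), (ENNReal.ofReal (localConst α) *
        ∫⁻ ζ in Metric.ball l √(m / α),
          (ω ζ * ‖weighted α f ζ‖ₑ) * kernel' t (z - ζ)) ^ p :=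
        setLIntegral_mono' Metric.isOpen_ball.measurableSet fun z hz ↦
          ENNReal.rpow_le_rpow (key z hz) (by linarith)
    _ ≤ _ := setLIntegral_le_lintegral _ _
    _ ≤ _ := lintegral_setConvolution_rpow_le hp (hω.mul hfm) (measurable_kernel' t)
        Metric.isOpen_ball.measurableSet _

/-- Write `f = (f - g) + g` on the inner disc, apply the inner estimate to `g`, and return through
`g = (g - f) + f` on the full disc. The two splittings account for `4^(p-1) = 2^(p-1) · 2^(p-1)`. -/
lemma setLIntegral_inner_le_add {α p : ℝ} (hα : 0 < α) (hp : 1 < p) {m : ℕ}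
    (hm : 6 ≤ √(m : ℝ)) (hm' : 2 * √α ≤ √(m : ℝ)) {f g : ℂ → ℂ} (hf : Differentiable ℂ f)
    (hg : Differentiable ℂ g) {l : ℂ} (hg0 : ∀ k < m, iteratedDeriv k g l = 0)
    {t : ℝ} (ht : 0 < t) :
    ∫⁻ z in Metric.ball l (√(m / α) - (t + 1)), ‖weighted α f z‖ₑ ^ p ≤
      (2 ^ (p - 1) + 4 ^ (p - 1) * innerConst α p t) * norm α p (f - g) ^ p +
      4 ^ (p - 1) * innerConst α p t *
        ∫⁻ z in Metric.ball l √(m / α), ‖weighted α f z‖ₑ ^ p := by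
  set D := Metric.ball l √(m / α)
  set D' := Metric.ball l (√(m / α) - (t + 1))
  have h1 := setLIntegral_weighted_add_le (α := α) hp.le (f := f - g) (g := g)
    (hf.sub hg).continuous D'
  have h2 := setLIntegral_inner_le hα hp hm hm' hg hg0 ht (ω := fun _ ↦ 1) measurable_const
    (fun z ζ ↦ by
      rw [one_mul, ← ENNReal.ofReal_one]
      exact ENNReal.ofReal_le_ofReal (by linarith [norm_nonneg (z - ζ)]))
  have h3 := setLIntegral_weighted_add_le (α := α) hp.le (f := g - f) (g := f)
    (hg.sub hf).continuous D
  simp only [one_mul, sub_add_cancel] at h1 h2 h3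
  have e : ∀ z, ‖weighted α (g - f) z‖ₑ = ‖weighted α (f - g) z‖ₑ := fun z ↦ by
    rw [weighted_sub, weighted_sub, enorm_sub_rev]
  simp_rw [e] at h3
  have h4 (E : Set ℂ) : ∫⁻ z in E, ‖weighted α (f - g) z‖ₑ ^ p ≤ norm α p (f - g) ^ p :=
    (setLIntegral_le_lintegral _ _).trans_eq (norm_rpow (by linarith) _ _).symm
  have h42 : (4 : ℝ≥0∞) ^ (p - 1) = 2 ^ (p - 1) * 2 ^ (p - 1) := by
    rw [← ENNReal.mul_rpow_of_nonneg _ _ (by linarith)]; norm_num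
  calc _ ≤ _ := h1
    _ ≤ 2 ^ (p - 1) * (norm α p (f - g) ^ p + innerConst α p t * (2 ^ (p - 1) *
        (norm α p (f - g) ^ p + ∫⁻ z in D, ‖weighted α f z‖ₑ ^ p))) := by
      refine mul_le_mul_right (add_le_add ?_ ?_) _
      · exact h4 D'
      · refine h2.trans ?_
        gcongr
        refine h3.trans ?_
        gcongr
        exact h4 D
    _ = _ := by rw [h42]; ring

/-- The map `x ↦ A x^p + Y` is monotone and, as `A` is finite, continuous, so it commutes with the
infimum that defines the quotient norm. -/
lemma le_mul_quotientNorm_rpow_add {α p : ℝ} (hp : 0 < p) {l : ℂ} {m : ℕ} {f : ℂ → ℂ}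
    {X A Y : ℝ≥0∞} (hA : A ≠ ∞) (h : ∀ g ∈ vanishing α p l m, X ≤ A * norm α p (f - g) ^ p + Y) :
    X ≤ A * quotientNorm α p l m f ^ p + Y := by
  have hne : Nonempty (vanishing α p l m) :=
    ⟨⟨0, zero_mem_space α p, fun k _ ↦ by
      have : (0 : ℂ → ℂ) = fun _ ↦ 0 := rfl
      rw [this, iteratedDeriv_const]; simp⟩⟩
  have hmono : Monotone fun x : ℝ≥0∞ ↦ A * x ^ p + Y := fun x y hxy ↦ by
    dsimp only; gcongr
  have hcont : Continuous fun x : ℝ≥0∞ ↦ A * x ^ p + Y :=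
    ((ENNReal.continuous_const_mul hA).comp ENNReal.continuous_rpow_const).add continuous_const
  rw [quotientNorm, iInf_subtype', hmono.map_ciInf_of_continuousAt hcont.continuousAt]
  exact le_iInf fun g ↦ h g g.2

/-- The inner estimate for quotient norms. -/
lemma setLIntegral_le_quotientNorm {α p : ℝ} (hα : 0 < α) (hp : 1 < p) {m : ℕ}
    (hm : 6 ≤ √(m : ℝ)) (hm' : 2 * √α ≤ √(m : ℝ)) {f : ℂ → ℂ} (hf : Differentiable ℂ f)
    (l : ℂ) {t : ℝ} (ht : 1 ≤ t) :
    ∫⁻ z in Metric.ball l (√(m / α) - (t + 1)), ‖weighted α f z‖ₑ ^ p ≤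
      (2 ^ (p - 1) + 4 ^ (p - 1) * innerConst α p t) * quotientNorm α p l m f ^ p +
      4 ^ (p - 1) * innerConst α p t *
        ∫⁻ z in Metric.ball l √(m / α), ‖weighted α f z‖ₑ ^ p := by
  refine le_mul_quotientNorm_rpow_add (by linarith) ?_ fun g hg ↦
    setLIntegral_inner_le_add hα hp hm hm' hf hg.1.1 hg.2 (by linarith)
  have h : innerConst α p t < ∞ := ENNReal.rpow_lt_top_of_nonneg (by linarith)
    (ENNReal.mul_lt_top ENNReal.ofReal_lt_top ((lintegral_mono (kernel'_anti ht)).trans_lt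
      lintegral_kernel'_one)).ne
  have h2 : (2 : ℝ≥0∞) ^ (p - 1) < ∞ := ENNReal.rpow_lt_top_of_nonneg (by linarith) (by simp)
  have h4 : (4 : ℝ≥0∞) ^ (p - 1) < ∞ := ENNReal.rpow_lt_top_of_nonneg (by linarith) (by simp)
  exact (ENNReal.add_lt_top.2 ⟨h2, ENNReal.mul_lt_top h4 h⟩).ne

end LocalEstimates

/-! ### Overlap counting, coherent states and point evaluations. -/

section TestFunctions

open MeasureTheory

/-- Each enlarged disc containing `z` meets `D(z, s + r₀)`, before enlargement, in a set that
contains a disc of radius `r₀/2`. Integrating the overlap bound over `D(z, s + r₀)` therefore counts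
these discs. -/
lemma tsum_indicator_ball_enlarge {ι : Type*} [Countable ι] {c : ι → ℂ} {r : ι → ℝ}
    {r₀ s : ℝ} (hr₀ : 0 < r₀) (hs : 0 ≤ s) {J : ℝ≥0∞}
    (hJ : ∀ z, ∑' i, (Metric.ball (c i) (r i)).indicator (fun _ ↦ (1 : ℝ≥0∞)) z ≤ J) (z : ℂ) :
    ∑' i, (if r₀ ≤ r i then (Metric.ball (c i) (r i + s)).indicator (fun _ ↦ (1 : ℝ≥0∞)) z else 0) ≤
      volume (Metric.ball (0 : ℂ) (s + r₀)) / volume (Metric.ball (0 : ℂ) (r₀ / 2)) * J := by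
  have hv0 : volume (Metric.ball (0 : ℂ) (r₀ / 2)) ≠ 0 :=
    (Metric.measure_ball_pos _ _ (by positivity)).ne'
  have hvt : volume (Metric.ball (0 : ℂ) (r₀ / 2)) ≠ ∞ := measure_ball_lt_top.ne
  rw [ENNReal.mul_comm_div, mul_div_assoc', ENNReal.le_div_iff_mul_le (Or.inl hv0) (Or.inl hvt),
    ← ENNReal.tsum_mul_right]
  have key (i : ι) : (if r₀ ≤ r i then
      (Metric.ball (c i) (r i + s)).indicator (fun _ ↦ (1 : ℝ≥0∞)) z else 0) *
        volume (Metric.ball (0 : ℂ) (r₀ / 2)) ≤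
      ∫⁻ w in Metric.ball z (s + r₀), (Metric.ball (c i) (r i)).indicator (fun _ ↦ 1) w := by
    split_ifs with hi
    swap
    · simp
    by_cases hz : z ∈ Metric.ball (c i) (r i + s)
    swap
    · simp [hz]
    rw [Set.indicator_of_mem hz, one_mul, lintegral_indicator_const Metric.isOpen_ball.measurableSet,
      one_mul, Measure.restrict_apply Metric.isOpen_ball.measurableSet]
    -- The centre `y` is `z`, or the point of the segment from `c i` to `z` at distance `r i - r₀/2`
    -- from `c i`.
    obtain ⟨y, hy1, hy2⟩ : ∃ y, dist y (c i) ≤ r i - r₀ / 2 ∧ dist y z ≤ s + r₀ / 2 := by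
      rw [Metric.mem_ball, dist_eq_norm] at hz
      rcases le_or_gt ‖z - c i‖ (r i - r₀ / 2) with h | h
      · exact ⟨z, by rwa [dist_eq_norm], by rw [dist_self]; positivity⟩
      · have hpos : 0 < r i - r₀ / 2 := by linarith
        have hzpos : 0 < ‖z - c i‖ := hpos.trans h
        refine ⟨c i + ((r i - r₀ / 2) / ‖z - c i‖ : ℝ) * (z - c i), ?_, ?_⟩
        · rw [dist_eq_norm, add_sub_cancel_left, norm_mul, Complex.norm_real, Real.norm_eq_abs,
            abs_of_pos (by positivity), div_mul_cancel₀ _ hzpos.ne']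
        · have : c i + ((r i - r₀ / 2) / ‖z - c i‖ : ℝ) * (z - c i) - z =
              ((r i - r₀ / 2) / ‖z - c i‖ - 1 : ℝ) * (z - c i) := by push_cast; ring
          rw [dist_eq_norm, this, norm_mul, Complex.norm_real, Real.norm_eq_abs,
            abs_sub_comm, abs_of_nonneg, sub_mul, div_mul_cancel₀ _ hzpos.ne']
          · linarith
          · rw [sub_nonneg, div_le_one hzpos]; exact h.le
    calc volume (Metric.ball (0 : ℂ) (r₀ / 2)) = volume (Metric.ball y (r₀ / 2)) := by
          rw [Measure.addHaar_ball_center volume y]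
      _ ≤ _ := measure_mono fun w hw ↦ by
          rw [Metric.mem_ball] at hw
          constructor
          · have := dist_triangle w y (c i)
            rw [Metric.mem_ball]; linarith
          · have := dist_triangle w y z
            rw [Metric.mem_ball]; linarith
  calc _ ≤ ∑' i, ∫⁻ w in Metric.ball z (s + r₀),
        (Metric.ball (c i) (r i)).indicator (fun _ ↦ 1) w := ENNReal.tsum_le_tsum key
    _ = ∫⁻ w in Metric.ball z (s + r₀),
        ∑' i, (Metric.ball (c i) (r i)).indicator (fun _ ↦ 1) w := by
        rw [lintegral_tsum fun i ↦ (measurable_const.indicator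
          Metric.isOpen_ball.measurableSet).aemeasurable]
    _ ≤ ∫⁻ w in Metric.ball z (s + r₀), J := lintegral_mono fun w ↦ hJ w
    _ = _ := by
        rw [setLIntegral_const, Measure.addHaar_ball_center, mul_comm]

lemma tsum_setLIntegral_le {ι : Type*} [Countable ι] {E : ι → Set ℂ}
    (hE : ∀ i, MeasurableSet (E i)) {J : ℝ≥0∞}
    (hJ : ∀ z, ∑' i, (E i).indicator (fun _ ↦ (1 : ℝ≥0∞)) z ≤ J) {F : ℂ → ℝ≥0∞}
    (hF : Measurable F) :
    ∑' i, ∫⁻ z in E i, F z ≤ J * ∫⁻ z, F z := by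
  simp_rw [← lintegral_indicator (hE _)]
  rw [← lintegral_tsum fun i ↦ (hF.indicator (hE i)).aemeasurable, ← lintegral_const_mul _ hF]
  refine lintegral_mono fun z ↦ ?_
  have : ∀ i, (E i).indicator F z = (E i).indicator (fun _ ↦ 1) z * F z := fun i ↦ by
    by_cases h : z ∈ E i <;> simp [h]
  dsimp only
  simp_rw [this]
  rw [ENNReal.tsum_mul_right]
  gcongr
  exact hJ z

lemma Divisor.countable_points (X : Divisor) : Countable X.points := X.countable_support

lemma Divisor.one_le_mult {X : Divisor} (l : X.points) : 1 ≤ X.mult l :=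
  Nat.one_le_iff_ne_zero.2 l.2

lemma Divisor.tsum_indicator_le_overlap (X : Divisor) (α : ℝ) (z : ℂ) :
    ∑' l : X.points, (Metric.ball (l : ℂ) (X.radius α l)).indicator (fun _ ↦ (1 : ℝ≥0∞)) z ≤
      X.overlap α :=
  le_iSup (fun z ↦ ∑' l : X.points,
    (Metric.ball (l : ℂ) (X.radius α l)).indicator (fun _ ↦ (1 : ℝ≥0∞)) z) z

/-- The factor by which the overlap grows when the radii are increased by `4`. -/
def overlapFactor (α : ℝ) : ℝ≥0∞ :=
  volume (Metric.ball (0 : ℂ) (4 + √(1 / α))) / volume (Metric.ball (0 : ℂ) (√(1 / α) / 2))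

lemma overlapFactor_lt_top {α : ℝ} (hα : 0 < α) : overlapFactor α < ∞ :=
  ENNReal.div_lt_top measure_ball_lt_top.ne (Metric.measure_ball_pos _ _ (by positivity)).ne'

lemma Divisor.tsum_indicator_enlarge_le (X : Divisor) {α : ℝ} (hα : 0 < α) (z : ℂ) :
    ∑' l : X.points, (Metric.ball (l : ℂ) (X.radius α l + 4)).indicator (fun _ ↦ (1 : ℝ≥0∞)) z ≤
      overlapFactor α * X.overlap α := by
  have := X.countable_points
  -- Multiplicities are at least `1`, so no radius is smaller than `√(1/α)`.
  have h := tsum_indicator_ball_enlarge (c := fun l : X.points ↦ (l : ℂ))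
    (r := fun l ↦ X.radius α l) (r₀ := √(1 / α)) (s := 4) (by positivity) (by norm_num)
    (X.tsum_indicator_le_overlap α) z
  refine le_trans (le_of_eq (tsum_congr fun l ↦ ?_)) h
  rw [if_pos]
  refine Real.sqrt_le_sqrt ?_
  gcongr
  exact_mod_cast X.one_le_mult l

lemma Divisor.tsum_quotientNorm_le (X : Divisor) {α p : ℝ} (hα : 0 < α) (hp : 1 < p)
    {f : ℂ → ℂ} (hf : f ∈ space α p) :
    ∑' l : X.points, quotientNorm α p l (X.mult l) f ^ p ≤ outerConst α p *
      ∑' l : X.points, ∫⁻ z in Metric.ball (l : ℂ) (X.radius α l + 4), ‖weighted α f z‖ₑ ^ p := by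
  rw [← ENNReal.tsum_mul_left]
  exact ENNReal.tsum_le_tsum fun l ↦ quotientNorm_rpow_le hα hp hf l (X.one_le_mult l)

/-- The normalized reproducing kernel at `a`. -/
def coherent (α : ℝ) (a : ℂ) : ℂ → ℂ := transl α (-a) 1

lemma coherent_differentiable (α : ℝ) (a : ℂ) : Differentiable ℂ (coherent α a) :=
  transl_differentiable (differentiable_const 1)

lemma enorm_weighted_coherent (α : ℝ) (a z : ℂ) :
    ‖weighted α (coherent α a) z‖ₑ = ENNReal.ofReal (Real.exp (-α * ‖z - a‖ ^ 2 / 2)) := by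
  rw [coherent, enorm_weighted_transl, enorm_weighted, ← sub_eq_add_neg]
  simp

/-- The function `exp(-p α |z|² / 2)`. -/
def gauss (α p : ℝ) (z : ℂ) : ℝ≥0∞ := ENNReal.ofReal (Real.exp (-α * ‖z‖ ^ 2 / 2)) ^ p

lemma measurable_gauss (α p : ℝ) : Measurable (gauss α p) := by
  unfold gauss
  fun_prop

lemma enorm_weighted_coherent_rpow (α p : ℝ) (a z : ℂ) :
    ‖weighted α (coherent α a) z‖ₑ ^ p = gauss α p (z - a) := by
  rw [enorm_weighted_coherent, gauss]

lemma lintegral_gauss_lt_top {α p : ℝ} (hα : 0 < α) (hp : 0 < p) : ∫⁻ z, gauss α p z < ∞ := by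
  have hb : 0 < p * α / 2 := by positivity
  have hi : Integrable fun z : ℂ ↦ Real.exp (-(p * α / 2) * ‖z‖ ^ 2) := by
    by_contra h
    have h1 := integral_undef h
    have h2 := GaussianFourier.integral_rexp_neg_mul_sq_norm (V := ℂ) hb
    rw [h1] at h2
    have : 0 < (Real.pi / (p * α / 2)) ^ ((Module.finrank ℝ ℂ : ℝ) / 2) := by positivity
    linarith
  have e : ∀ z, gauss α p z = ENNReal.ofReal (Real.exp (-(p * α / 2) * ‖z‖ ^ 2)) := fun z ↦ by
    rw [gauss, ENNReal.ofReal_rpow_of_pos (Real.exp_pos _), ← Real.exp_mul]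
    congr 2; ring
  simp_rw [e]
  exact hi.lintegral_lt_top

lemma gauss_pos (α : ℝ) (p : ℝ) (z : ℂ) : 0 < gauss α p z :=
  ENNReal.rpow_pos (by simpa using Real.exp_pos _) ENNReal.ofReal_ne_top

lemma setLIntegral_gauss_ball_pos (α p : ℝ) : 0 < ∫⁻ z in Metric.ball 0 1, gauss α p z := by
  rw [setLIntegral_pos_iff (measurable_gauss α p)]
  have : Function.support (gauss α p) = Set.univ :=
    Set.eq_univ_of_forall fun z ↦ (gauss_pos α p z).ne'
  rw [this, Set.univ_inter]
  exact Metric.measure_ball_pos _ _ one_pos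

lemma tendsto_setLIntegral_gauss {α p : ℝ} (hα : 0 < α) (hp : 0 < p) :
    Filter.Tendsto (fun r : ℝ ↦ ∫⁻ z in (Metric.ball 0 r)ᶜ, gauss α p z) Filter.atTop (nhds 0) := by
  simp_rw [← lintegral_indicator Metric.isOpen_ball.measurableSet.compl]
  have := tendsto_lintegral_filter_of_dominated_convergence (μ := (volume : Measure ℂ))
    (l := Filter.atTop) (F := fun (r : ℝ) w ↦ (Metric.ball 0 r)ᶜ.indicator (gauss α p) w)
    (f := fun _ ↦ 0) (gauss α p)
    (Filter.Eventually.of_forall fun r ↦ (measurable_gauss α p).indicator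
      Metric.isOpen_ball.measurableSet.compl)
    (Filter.Eventually.of_forall fun r ↦ Filter.Eventually.of_forall fun w ↦
      Set.indicator_le_self _ _ _) (lintegral_gauss_lt_top hα hp).ne
    (Filter.Eventually.of_forall fun w ↦ tendsto_const_nhds.congr' <|
      (Filter.eventually_gt_atTop ‖w‖).mono fun t ht ↦ by
        dsimp only
        rw [Set.indicator_of_notMem (by simpa using ht)])
  simpa using this

lemma lintegral_coherent (α p : ℝ) (a : ℂ) :
    ∫⁻ z, ‖weighted α (coherent α a) z‖ₑ ^ p = ∫⁻ z, gauss α p z := by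
  simp_rw [enorm_weighted_coherent_rpow]
  exact lintegral_sub_right_eq_self (gauss α p) a

lemma setLIntegral_coherent (α p : ℝ) (a : ℂ) (r : ℝ) :
    ∫⁻ z in Metric.ball a r, ‖weighted α (coherent α a) z‖ₑ ^ p =
      ∫⁻ z in Metric.ball 0 r, gauss α p z := by
  simp_rw [enorm_weighted_coherent_rpow]
  rw [← setLIntegral_ball_add]
  simp

lemma setLIntegral_compl_coherent (α p : ℝ) (a : ℂ) (r : ℝ) :
    ∫⁻ z in (Metric.ball a r)ᶜ, ‖weighted α (coherent α a) z‖ₑ ^ p =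
      ∫⁻ z in (Metric.ball 0 r)ᶜ, gauss α p z := by
  simp_rw [enorm_weighted_coherent_rpow]
  have hm := Metric.isOpen_ball.measurableSet.compl (s := Metric.ball a r)
  have hm' := Metric.isOpen_ball.measurableSet.compl (s := Metric.ball (0 : ℂ) r)
  rw [← lintegral_indicator hm, ← lintegral_indicator hm',
    ← lintegral_sub_right_eq_self ((Metric.ball (0 : ℂ) r)ᶜ.indicator fun z ↦ gauss α p z) a]
  refine lintegral_congr fun z ↦ ?_
  simp [Set.indicator, dist_eq_norm]

lemma coherent_mem_space {α p : ℝ} (hα : 0 < α) (hp : 0 < p) (a : ℂ) :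
    coherent α a ∈ space α p :=
  (mem_space_iff hp).2 ⟨coherent_differentiable α a,
    (lintegral_coherent α p a).trans_lt (lintegral_gauss_lt_top hα hp)⟩

/-- The constant in the bound for point evaluations. -/
def evalConst (α p : ℝ) : ℝ≥0∞ :=
  ENNReal.ofReal (Real.exp (2 * α)) ^ p * volume (Metric.ball (0 : ℂ) 2) ^ (p - 1)

lemma evalConst_lt_top (α : ℝ) {p : ℝ} (hp : 1 < p) : evalConst α p < ∞ :=
  ENNReal.mul_lt_top (ENNReal.rpow_lt_top_of_nonneg (by linarith) ENNReal.ofReal_ne_top)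
    (ENNReal.rpow_lt_top_of_nonneg (by linarith) measure_ball_lt_top.ne)

lemma lintegral_rpow_le_of_one_lt {p : ℝ} (hp : 1 < p) {μ : Measure ℂ} {u : ℂ → ℝ≥0∞}
    (hu : Measurable u) : (∫⁻ z, u z ∂μ) ^ p ≤ μ Set.univ ^ (p - 1) * ∫⁻ z, u z ^ p ∂μ := by
  have hp0 : 0 < p := by linarith
  have hpq := Real.HolderConjugate.conjExponent hp
  have h := ENNReal.lintegral_mul_le_Lp_mul_Lq μ hpq hu.aemeasurable
    (g := fun _ ↦ 1) aemeasurable_const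
  simp only [Pi.mul_apply, mul_one, ENNReal.one_rpow, lintegral_const, one_mul] at h
  refine (ENNReal.rpow_le_rpow h hp0.le).trans_eq ?_
  rw [ENNReal.mul_rpow_of_nonneg _ _ hp0.le, ← ENNReal.rpow_mul, ← ENNReal.rpow_mul,
    one_div_mul_cancel hp0.ne', ENNReal.rpow_one, mul_comm]
  congr 2
  have e1 : p⁻¹ + p.conjExponent⁻¹ = 1 := hpq.inv_add_inv_eq_one
  have : p.conjExponent⁻¹ = 1 - p⁻¹ := by linarith
  rw [one_div, this, sub_mul, inv_mul_cancel₀ hp0.ne', one_mul]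

/-- At the origin, Cauchy's formula is averaged over the annulus `1 < |ζ| < 2`, where the weight is
at least `exp(-2α)`; Hölder and a translation give the general case. -/
lemma enorm_weighted_rpow_le {α p : ℝ} (hα : 0 < α) (hp : 1 < p) {f : ℂ → ℂ}
    (hf : Differentiable ℂ f) (z : ℂ) :
    ‖weighted α f z‖ₑ ^ p ≤ evalConst α p * norm α p f ^ p := by
  have hp0 : 0 < p := by linarith
  have h0 (g : ℂ → ℂ) (hg : Differentiable ℂ g) : ‖g 0‖ₑ ≤
      ENNReal.ofReal (Real.exp (2 * α)) * ∫⁻ ζ in Metric.ball 0 2, ‖weighted α g ζ‖ₑ := by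
    have hm : Measurable g := hg.continuous.measurable
    have hA : MeasurableSet {ζ : ℂ | 1 < ‖ζ‖ ∧ ‖ζ‖ < 1 + 1} :=
      (measurableSet_lt measurable_const measurable_norm).inter
        (measurableSet_lt measurable_norm measurable_const)
    have h1 : ‖g 0‖ₑ ≤ ∫⁻ ζ in {ζ : ℂ | 1 < ‖ζ‖ ∧ ‖ζ‖ < 1 + 1}, ‖(ζ - 0)⁻¹ • g ζ‖ₑ := by
      refine le_lintegral_annulus zero_le_one (by fun_prop) fun ρ hρ ↦ ?_
      have hρ0 : 0 < ρ := one_pos.trans hρ.1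
      have := enorm_circleIntegral_le (F := fun ζ ↦ (ζ - 0)⁻¹ • g ζ) hρ0
      rw [hg.differentiableOn.circleIntegral_sub_inv_smul (Metric.mem_ball_self hρ0),
        smul_eq_mul, inv_mul_cancel_left₀ Complex.two_pi_I_ne_zero] at this
      exact this
    refine h1.trans ?_
    rw [← lintegral_const_mul' _ _ ENNReal.ofReal_ne_top]
    refine (setLIntegral_mono' hA fun ζ hζ ↦ ?_).trans (lintegral_mono_set fun ζ hζ ↦ by
      simpa [one_add_one_eq_two] using hζ.2)
    rw [enorm_weighted, mul_left_comm, ← ENNReal.ofReal_mul (Real.exp_pos _).le, ← Real.exp_add,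
      smul_eq_mul, enorm_mul, mul_comm]
    gcongr
    rw [← ofReal_norm]
    refine ENNReal.ofReal_le_ofReal ?_
    rw [sub_zero, norm_inv]
    calc ‖ζ‖⁻¹ ≤ 1 := inv_le_one_of_one_le₀ hζ.1.le
      _ = Real.exp 0 := Real.exp_zero.symm
      _ ≤ _ := Real.exp_le_exp.2 (by
            have h4 : ‖ζ‖ ^ 2 ≤ 4 := by nlinarith [hζ.1, hζ.2, norm_nonneg ζ]
            nlinarith [mul_le_mul_of_nonneg_left h4 hα.le])
  have hF := transl_differentiable (α := α) (l := z) hf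
  have h1 := h0 _ hF
  have e : ‖transl α z f 0‖ₑ = ‖weighted α f z‖ₑ := by
    have := enorm_weighted_transl α z f 0
    rw [zero_add, enorm_weighted α (transl α z f)] at this
    simpa using this
  rw [e] at h1
  calc _ ≤ _ := ENNReal.rpow_le_rpow h1 hp0.le
    _ ≤ ENNReal.ofReal (Real.exp (2 * α)) ^ p * (volume (Metric.ball (0 : ℂ) 2) ^ (p - 1) *
        ∫⁻ ζ in Metric.ball 0 2, ‖weighted α (transl α z f) ζ‖ₑ ^ p) := by
        rw [ENNReal.mul_rpow_of_nonneg _ _ hp0.le]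
        gcongr
        refine (lintegral_rpow_le_of_one_lt hp (measurable_weighted α hF.continuous)).trans_eq ?_
        rw [Measure.restrict_apply_univ]
    _ ≤ ENNReal.ofReal (Real.exp (2 * α)) ^ p * (volume (Metric.ball (0 : ℂ) 2) ^ (p - 1) *
        ∫⁻ ζ, ‖weighted α (transl α z f) ζ‖ₑ ^ p) := by
        gcongr
        exact Measure.restrict_le_self
    _ = _ := by
        simp_rw [enorm_weighted_transl]
        rw [lintegral_add_right_eq_self (fun ζ ↦ ‖weighted α f ζ‖ₑ ^ p) z, norm_rpow hp0,
          evalConst, mul_assoc]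

/-- Evaluation at `l` annihilates the vanishing subspace. This replaces the inner estimate at points
of small multiplicity. -/
lemma enorm_weighted_rpow_le_quotientNorm {α p : ℝ} (hα : 0 < α) (hp : 1 < p) {f : ℂ → ℂ}
    (hf : Differentiable ℂ f) {l : ℂ} {m : ℕ} (hm : 1 ≤ m) :
    ‖weighted α f l‖ₑ ^ p ≤ evalConst α p * quotientNorm α p l m f ^ p := by
  have := le_mul_quotientNorm_rpow_add (α := α) (by linarith) (evalConst_lt_top α hp).ne
    (X := ‖weighted α f l‖ₑ ^ p) (Y := 0) (l := l) (m := m) (f := f) fun g hg ↦ by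
      have h0 : g l = 0 := by simpa using hg.2 0 (by omega)
      have := enorm_weighted_rpow_le hα hp (hf.sub hg.1.1) l
      rw [weighted_sub, show weighted α g l = 0 by simp [weighted, h0], sub_zero] at this
      simpa using this
  simpa using this

end TestFunctions

/-! ### Sampling implies finite overlap and covering. -/

section Necessity

open MeasureTheory

/-- The constant of the inner estimate for quotient norms. -/
def quotConst (α p t : ℝ) : ℝ≥0∞ := 2 ^ (p - 1) + 4 ^ (p - 1) * innerConst α p t

lemma innerConst_lt_top (α : ℝ) {p t : ℝ} (hp : 1 < p) (ht : 1 ≤ t) : innerConst α p t < ∞ :=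
  ENNReal.rpow_lt_top_of_nonneg (by linarith)
    (ENNReal.mul_lt_top ENNReal.ofReal_lt_top ((lintegral_mono (kernel'_anti ht)).trans_lt
      lintegral_kernel'_one)).ne

lemma quotConst_lt_top (α : ℝ) {p t : ℝ} (hp : 1 < p) (ht : 1 ≤ t) : quotConst α p t < ∞ :=
  ENNReal.add_lt_top.2 ⟨ENNReal.rpow_lt_top_of_nonneg (by linarith) (by simp),
    ENNReal.mul_lt_top (ENNReal.rpow_lt_top_of_nonneg (by linarith) (by simp))
      (innerConst_lt_top α hp ht)⟩

/-- For every `η > 0`, the small constant in the inner estimate for quotient norms is less than `η`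
at some distance `t` that is large compared with `1` and `1/√α`. -/
lemma exists_innerConst_lt (α : ℝ) {p : ℝ} (hp : 1 < p) {η : ℝ≥0∞} (hη : 0 < η) :
    ∃ t : ℝ, 2 ≤ t ∧ 6 / √α ≤ t ∧ 4 ^ (p - 1) * innerConst α p t < η := by
  have h := ENNReal.Tendsto.const_mul (a := (4 : ℝ≥0∞) ^ (p - 1))
    (tendsto_innerConst α (p := p) (by linarith))
    (Or.inr (ENNReal.rpow_lt_top_of_nonneg (by linarith) (by simp)).ne)
  rw [mul_zero] at h
  obtain ⟨t, ht⟩ := ((h.eventually_lt_const hη).and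
    ((Filter.eventually_ge_atTop 2).and (Filter.eventually_ge_atTop (6 / √α)))).exists
  exact ⟨t, ht.2.1, ht.2.2, ht.1⟩

lemma sqrt_mult_bounds {α t : ℝ} (hα : 0 < α) (ht : 2 ≤ t) (ht' : 6 / √α ≤ t) {m : ℕ}
    (hm : t ≤ √(m / α)) : 6 ≤ √(m : ℝ) ∧ 2 * √α ≤ √(m : ℝ) := by
  have hb : 0 < √α := Real.sqrt_pos.2 hα
  rw [Real.sqrt_div' _ hα.le, le_div_iff₀ hb] at hm
  rw [div_le_iff₀ hb] at ht'
  exact ⟨ht'.trans hm, le_trans (by gcongr) hm⟩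

/-- The sampling sum of the coherent state at `z` is at most `B * G`, independently of `z`, while
every disc through `z` is charged to it: large discs through a shrunken copy containing `z`, small
discs through evaluation at their centre. -/
lemma Divisor.IsSampling.finiteOverlap {X : Divisor} {α p : ℝ} (hα : 0 < α) (hp : 1 < p)
    (hX : X.IsSampling α p) : X.FiniteOverlap α := by
  have hp0 : 0 < p := by linarith
  obtain ⟨A, B, hA, hB, hAB⟩ := hX
  have hcount := X.countable_points
  set G := ∫⁻ z, gauss α p z
  have hG : G < ∞ := lintegral_gauss_lt_top hα hp0
  set G₁ := ∫⁻ z in Metric.ball 0 1, gauss α p z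
  have hG₁ : 0 < G₁ := setLIntegral_gauss_ball_pos α p
  have hG₁G : G₁ ≤ G := setLIntegral_le_lintegral _ _
  have hG₁t : G₁ < ∞ := hG₁G.trans_lt hG
  -- With this threshold the error term of the inner estimate, at most a small constant times `G`,
  -- is at most half of the mass `G₁` of a coherent state on the unit disc around its centre.
  have hη : 0 < G₁ / 2 / G := ENNReal.div_pos (ENNReal.half_pos hG₁.ne').ne' hG.ne
  obtain ⟨t, ht2, ht6, ht⟩ := exists_innerConst_lt α hp hη
  have hup (z : ℂ) : ∑' l : X.points, quotientNorm α p l (X.mult l) (coherent α z) ^ p ≤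
      B * G := by
    have := (hAB _ (coherent_mem_space hα hp0 z)).2
    rwa [norm_rpow hp0, lintegral_coherent] at this
  -- The margin `t + 2` leaves room for the unit disc around `z` inside the disc of radius `X.radius
  -- α l - (t + 1)` of the inner estimate.
  have hbig (z : ℂ) (l : X.points) :
      (Metric.ball (l : ℂ) (X.radius α l - (t + 2))).indicator (fun _ ↦ (1 : ℝ≥0∞)) z ≤
        quotConst α p t / (G₁ / 2) * quotientNorm α p l (X.mult l) (coherent α z) ^ p := by
    by_cases hz : z ∈ Metric.ball (l : ℂ) (X.radius α l - (t + 2))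
    swap
    · simp [hz]
    rw [Set.indicator_of_mem hz, ENNReal.mul_comm_div, mul_div_assoc', ENNReal.le_div_iff_mul_le
      (Or.inl (ENNReal.half_pos hG₁.ne').ne') (Or.inl (by finiteness)), one_mul]
    rw [Metric.mem_ball] at hz
    have hR : t ≤ √(X.mult l / α) := by
      change t ≤ X.radius α l
      linarith [dist_nonneg (x := z) (y := (l : ℂ))]
    obtain ⟨hm, hm'⟩ := sqrt_mult_bounds hα ht2 ht6 hR
    have h := setLIntegral_le_quotientNorm hα hp hm hm' (coherent_differentiable α z) l
      (t := t) (by linarith)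
    have h1 : G₁ ≤ ∫⁻ w in Metric.ball (l : ℂ) (√(X.mult l / α) - (t + 1)),
        ‖weighted α (coherent α z) w‖ₑ ^ p := by
      refine (setLIntegral_coherent α p z 1).symm.trans_le ?_
      refine lintegral_mono_set fun w hw ↦ ?_
      rw [Metric.mem_ball] at hw ⊢
      have := dist_triangle w z l
      change _ < X.radius α l - _
      linarith
    have h2 : 4 ^ (p - 1) * innerConst α p t * ∫⁻ w in Metric.ball (l : ℂ) √(X.mult l / α),
        ‖weighted α (coherent α z) w‖ₑ ^ p ≤ G₁ / 2 := by
      calc _ ≤ G₁ / 2 / G * G := by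
            gcongr
            exact (setLIntegral_le_lintegral _ _).trans_eq (lintegral_coherent α p z)
        _ = _ := ENNReal.div_mul_cancel (hG₁.trans_le hG₁G).ne' hG.ne
    have h3 := h1.trans (h.trans (add_le_add_right h2 _))
    have h4 : G₁ / 2 + G₁ / 2 = G₁ := ENNReal.add_halves _
    replace h3 := h4.trans_le h3
    exact (ENNReal.add_le_add_iff_right (by finiteness)).1 h3
  have hJ (z : ℂ) : ∑' l : X.points,
      (Metric.ball (l : ℂ) (X.radius α l - (t + 2))).indicator (fun _ ↦ (1 : ℝ≥0∞)) z ≤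
        quotConst α p t / (G₁ / 2) * (B * G) := by
    refine (ENNReal.tsum_le_tsum (hbig z)).trans ?_
    rw [ENNReal.tsum_mul_left]
    gcongr
    exact hup z
  have henl := tsum_indicator_ball_enlarge (c := fun l : X.points ↦ (l : ℂ))
    (r := fun l : X.points ↦ X.radius α l - (t + 2)) (r₀ := 1) (s := t + 2) one_pos
    (by linarith) hJ
  set V := volume (Metric.ball (0 : ℂ) (t + 2 + 1)) / volume (Metric.ball (0 : ℂ) (1 / 2)) *
    (quotConst α p t / (G₁ / 2) * (B * G))
  set w₀ := ENNReal.ofReal (Real.exp (-α * (t + 3) ^ 2 / 2)) ^ p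
  have hw₀ : 0 < w₀ := ENNReal.rpow_pos (by simpa using Real.exp_pos _) ENNReal.ofReal_ne_top
  have hw₀t : w₀ < ∞ := ENNReal.rpow_lt_top_of_nonneg hp0.le ENNReal.ofReal_ne_top
  -- Either the shrunken disc has radius at least `1` and can be enlarged back, or the original
  -- radius is less than `t + 3` and the coherent state at `l` is at least `exp(-α (t + 3)² / 2)` in
  -- the weight.
  have hall (z : ℂ) (l : X.points) :
      (Metric.ball (l : ℂ) (X.radius α l)).indicator (fun _ ↦ (1 : ℝ≥0∞)) z ≤
        (if 1 ≤ X.radius α l - (t + 2) then (Metric.ball (l : ℂ)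
          (X.radius α l - (t + 2) + (t + 2))).indicator (fun _ ↦ (1 : ℝ≥0∞)) z else 0) +
        evalConst α p / w₀ * quotientNorm α p l (X.mult l) (coherent α z) ^ p := by
    split_ifs with h
    · rw [sub_add_cancel]
      exact le_self_add
    rw [zero_add]
    by_cases hz : z ∈ Metric.ball (l : ℂ) (X.radius α l)
    swap
    · simp [hz]
    rw [Set.indicator_of_mem hz, ENNReal.mul_comm_div, mul_div_assoc', ENNReal.le_div_iff_mul_le
      (Or.inl hw₀.ne') (Or.inl hw₀t.ne), one_mul]
    refine le_trans ?_ (enorm_weighted_rpow_le_quotientNorm hα hp (coherent_differentiable α z)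
      (X.one_le_mult l))
    rw [enorm_weighted_coherent]
    refine ENNReal.rpow_le_rpow (ENNReal.ofReal_le_ofReal (Real.exp_le_exp.2 ?_)) hp0.le
    rw [Metric.mem_ball, dist_comm, dist_eq_norm] at hz
    have : ‖(l : ℂ) - z‖ ^ 2 ≤ (t + 3) ^ 2 := by gcongr; linarith
    nlinarith
  have hfin : V + evalConst α p / w₀ * (B * G) < ∞ := by
    have h1 : quotConst α p t / (G₁ / 2) < ∞ :=
      ENNReal.div_lt_top (quotConst_lt_top α hp (by linarith)).ne (ENNReal.half_pos hG₁.ne').ne'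
    have h2 : (B : ℝ≥0∞) * G < ∞ := ENNReal.mul_lt_top ENNReal.coe_lt_top hG
    refine ENNReal.add_lt_top.2 ⟨ENNReal.mul_lt_top (ENNReal.div_lt_top measure_ball_lt_top.ne
      (Metric.measure_ball_pos _ _ (by norm_num)).ne') (ENNReal.mul_lt_top h1 h2),
      ENNReal.mul_lt_top (ENNReal.div_lt_top (evalConst_lt_top α hp).ne hw₀.ne') h2⟩
  refine lt_of_le_of_lt (iSup_le fun z ↦ ?_) hfin
  refine (ENNReal.tsum_le_tsum (hall z)).trans ?_
  rw [ENNReal.tsum_add, ENNReal.tsum_mul_left]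
  gcongr
  · exact henl z
  · exact hup z

/-- The quotient norms of a coherent state centred at an uncovered point see only its tail outside
`D(z, r)`. For large `r` this contradicts the lower sampling bound. -/
lemma Divisor.IsSampling.exists_cover {X : Divisor} {α p : ℝ} (hα : 0 < α) (hp : 1 < p)
    (hX : X.IsSampling α p) :
    ∃ C : ℝ, 0 < C ∧ (⋃ l ∈ X.points, Metric.ball l (X.radius α l + C)) = Set.univ := by
  have hp0 : 0 < p := by linarith
  have hov := hX.finiteOverlap hα hp
  obtain ⟨A, B, hA, hB, hAB⟩ := hX
  have hcount := X.countable_points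
  set G := ∫⁻ z, gauss α p z
  have hG : 0 < G := (setLIntegral_gauss_ball_pos α p).trans_le (setLIntegral_le_lintegral _ _)
  set J := overlapFactor α * X.overlap α
  have hJ : J < ∞ := ENNReal.mul_lt_top (overlapFactor_lt_top hα) hov
  have htend := ENNReal.Tendsto.const_mul (a := outerConst α p * J)
    (tendsto_setLIntegral_gauss hα hp0)
    (Or.inr (ENNReal.mul_lt_top (outerConst_lt_top α hp) hJ).ne)
  rw [mul_zero] at htend
  obtain ⟨r, hr, hr0⟩ := ((htend.eventually_lt_const (u := A * G)
    (ENNReal.mul_pos (by exact_mod_cast hA.ne') hG.ne')).and (Filter.eventually_ge_atTop 0)).exists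
  -- The `4` is the enlargement of the discs in the outer estimate.
  refine ⟨r + 4, by linarith, Set.eq_univ_of_forall fun z ↦ ?_⟩
  by_contra hz
  simp only [Set.mem_iUnion, Metric.mem_ball, not_exists, not_lt] at hz
  refine absurd hr (not_lt.2 ?_)
  have hmem := coherent_mem_space hα hp0 z
  have h1 := (hAB _ hmem).1
  rw [norm_rpow hp0, lintegral_coherent] at h1
  refine h1.trans ((X.tsum_quotientNorm_le hα hp hmem).trans ?_)
  rw [mul_assoc]
  gcongr
  have hm := (measurable_weighted α (coherent_differentiable α z).continuous).pow_const p
  have hc := Metric.isOpen_ball.measurableSet.compl (s := Metric.ball z r)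
  calc _ ≤ ∑' l : X.points, ∫⁻ w in Metric.ball (l : ℂ) (X.radius α l + 4),
        (Metric.ball z r)ᶜ.indicator (fun w ↦ ‖weighted α (coherent α z) w‖ₑ ^ p) w := by
        refine ENNReal.tsum_le_tsum fun l ↦
          setLIntegral_mono' Metric.isOpen_ball.measurableSet fun w hw ↦ ?_
        rw [Set.indicator_of_mem]
        intro hw'
        rw [Metric.mem_ball] at hw hw'
        have := dist_triangle z w l
        rw [dist_comm z w] at this
        linarith [hz l l.2]
    _ ≤ J * ∫⁻ w, (Metric.ball z r)ᶜ.indicator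
          (fun w ↦ ‖weighted α (coherent α z) w‖ₑ ^ p) w :=
        tsum_setLIntegral_le (fun _ ↦ Metric.isOpen_ball.measurableSet)
          (X.tsum_indicator_enlarge_le hα) (hm.indicator hc)
    _ = _ := by rw [lintegral_indicator hc, setLIntegral_compl_coherent]

end Necessity

/-! ### Functions vanishing on the divisor. -/

section UniquenessSet

open MeasureTheory

lemma norm_lt_top {α p : ℝ} {f : ℂ → ℂ} (hf : f ∈ space α p) : norm α p f < ∞ := hf.2.2

lemma setLIntegral_compl_le_tsum {X : Divisor} {α C : ℝ} {K : Set ℂ}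
    (hcov : Kᶜ ⊆ ⋃ l ∈ {l | l ∈ X.points ∧ α * C ^ 2 < (X.mult l : ℝ)},
      Metric.ball l (X.radius α l - C)) (F : ℂ → ℝ≥0∞) :
    ∫⁻ z in Kᶜ, F z ≤ ∑' l : X.points, if α * C ^ 2 < (X.mult l : ℝ) then
      ∫⁻ z in Metric.ball (l : ℂ) (X.radius α l - C), F z else 0 := by
  have hcount := X.countable_points
  calc _ ≤ ∫⁻ z in ⋃ l : X.points, if α * C ^ 2 < (X.mult l : ℝ) then
        Metric.ball (l : ℂ) (X.radius α l - C) else ∅, F z := by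
        refine lintegral_mono_set (hcov.trans fun z hz ↦ ?_)
        simp only [Set.mem_iUnion] at hz ⊢
        obtain ⟨l, hl, hz⟩ := hz
        exact ⟨⟨l, hl.1⟩, by rwa [if_pos hl.2]⟩
    _ ≤ _ := lintegral_iUnion_le _ _
    _ = _ := tsum_congr fun l ↦ by split_ifs <;> simp

lemma lt_radius {α C : ℝ} (hα : 0 < α) (hC : 0 ≤ C) {m : ℕ} (h : α * C ^ 2 < m) :
    C < √(m / α) := by
  rw [Real.lt_sqrt hC, lt_div_iff₀ hα, mul_comm]
  exact h

lemma le_two_mul_of_le_add_half {T x : ℝ≥0∞} (hT : T ≠ ∞) (h : T ≤ x + 1 / 2 * T) : T ≤ 2 * x := by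
  have e : T = 1 / 2 * T + 1 / 2 * T := by rw [← add_mul, ENNReal.add_halves, one_mul]
  have h2 : 1 / 2 * T + 1 / 2 * T ≤ x + 1 / 2 * T := e ▸ h
  have h3 := (ENNReal.add_le_add_iff_right (ENNReal.mul_ne_top (by simp) hT)).1 h2
  calc T = 2 * (1 / 2 * T) := by
        rw [← mul_assoc, one_div, ENNReal.mul_inv_cancel (by simp) (by simp), one_mul]
    _ ≤ _ := by gcongr

section Uniqueness

variable {X : Divisor} {α p t ρ : ℝ} {S : ℝ≥0∞} {K : Set ℂ}

lemma setLIntegral_compl_vanishing_le (hα : 0 < α) (hp : 1 < p) (ht : 2 ≤ t) (ht' : 6 / √α ≤ t)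
    (hS : X.overlap α ≤ S)
    (hcov : Kᶜ ⊆ ⋃ l ∈ {l | l ∈ X.points ∧ α * (t + 1) ^ 2 < (X.mult l : ℝ)},
      Metric.ball l (X.radius α l - (t + 1)))
    {f : ℂ → ℂ} (hf : Differentiable ℂ f)
    (hf0 : ∀ l : X.points, ∀ k < X.mult l, iteratedDeriv k f l = 0) {ω : ℂ → ℝ≥0∞}
    (hω : Measurable ω) (hω' : ∀ z ζ, ω z ≤ ω ζ * ENNReal.ofReal (1 + ‖z - ζ‖)) :
    ∫⁻ z in Kᶜ, (ω z * ‖weighted α f z‖ₑ) ^ p ≤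
      innerConst α p t * S * ∫⁻ z, (ω z * ‖weighted α f z‖ₑ) ^ p := by
  have hcount := X.countable_points
  have hm := (hω.mul (measurable_weighted α hf.continuous)).pow_const p
  calc _ ≤ _ := setLIntegral_compl_le_tsum hcov _
    _ ≤ ∑' l : X.points, innerConst α p t *
        ∫⁻ z in Metric.ball (l : ℂ) (X.radius α l), (ω z * ‖weighted α f z‖ₑ) ^ p := by
        refine ENNReal.tsum_le_tsum fun l ↦ ?_
        split_ifs with h
        · obtain ⟨h1, h2⟩ := sqrt_mult_bounds hα ht ht'
            (by linarith [lt_radius hα (by linarith) h] : t ≤ √(X.mult l / α))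
          exact setLIntegral_inner_le hα hp h1 h2 hf (hf0 l) (by linarith) hω hω'
        · exact zero_le
    _ ≤ innerConst α p t * (S * ∫⁻ z, (ω z * ‖weighted α f z‖ₑ) ^ p) := by
        rw [ENNReal.tsum_mul_left]
        gcongr
        exact tsum_setLIntegral_le (fun _ ↦ Metric.isOpen_ball.measurableSet)
          (fun z ↦ (X.tsum_indicator_le_overlap α z).trans hS) hm
    _ = _ := by rw [mul_assoc]

/-- For a weight growing at most linearly, the inner estimates bound the integral off `K` by half of
the whole integral, and on `K` the weight is at most `1 + ρ`. Absorption needs a finite integral, so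
`1 + |z|` is truncated at `n` and recovered by monotone convergence. -/
lemma lintegral_one_add_norm_mul_le (hα : 0 < α) (hp : 1 < p) (ht : 2 ≤ t) (ht' : 6 / √α ≤ t)
    (hS : X.overlap α ≤ S) (hη : innerConst α p t * S ≤ 1 / 2)
    (hcov : Kᶜ ⊆ ⋃ l ∈ {l | l ∈ X.points ∧ α * (t + 1) ^ 2 < (X.mult l : ℝ)},
      Metric.ball l (X.radius α l - (t + 1)))
    (hK : MeasurableSet K) (hKρ : K ⊆ Metric.closedBall 0 ρ)
    {f : ℂ → ℂ} (hf : f ∈ space α p)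
    (hf0 : ∀ l : X.points, ∀ k < X.mult l, iteratedDeriv k f l = 0) :
    ∫⁻ z, (ENNReal.ofReal (1 + ‖z‖) * ‖weighted α f z‖ₑ) ^ p ≤
      2 * ENNReal.ofReal (1 + ρ) ^ p * ∫⁻ z, ‖weighted α f z‖ₑ ^ p := by
  have hp0 : 0 < p := by linarith
  have hfm := measurable_weighted α hf.1.continuous
  have hfin := ((mem_space_iff hp0).1 hf).2
  set ω : ℕ → ℂ → ℝ≥0∞ := fun n z ↦ ENNReal.ofReal (min (1 + ‖z‖) n) with hωdef
  have hωm (n : ℕ) : Measurable (ω n) := by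
    simp only [hωdef]; fun_prop
  have key (n : ℕ) : ∫⁻ z, (ω n z * ‖weighted α f z‖ₑ) ^ p ≤
      2 * ENNReal.ofReal (1 + ρ) ^ p * ∫⁻ z, ‖weighted α f z‖ₑ ^ p := by
    have h1 := setLIntegral_compl_vanishing_le hα hp ht ht' hS hcov hf.1 hf0 (hωm n) fun z ζ ↦ by
      simp only [hωdef]
      rw [← ENNReal.ofReal_mul' (by positivity)]
      refine ENNReal.ofReal_le_ofReal ?_
      have h := norm_le_norm_add_norm_sub' z ζ
      have h0 := norm_nonneg (z - ζ)
      have h1 := norm_nonneg ζ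
      have hn : (0 : ℝ) ≤ n := Nat.cast_nonneg n
      rcases le_total (1 + ‖ζ‖) n with h' | h'
      · rw [min_eq_left h']
        exact (min_le_left _ _).trans (by nlinarith)
      · rw [min_eq_right h']
        exact (min_le_right _ _).trans (by nlinarith)
    have hT : ∫⁻ z, (ω n z * ‖weighted α f z‖ₑ) ^ p < ∞ := by
      calc _ ≤ ∫⁻ z, (n : ℝ≥0∞) ^ p * ‖weighted α f z‖ₑ ^ p := by
            refine lintegral_mono fun z ↦ ?_
            rw [← ENNReal.mul_rpow_of_nonneg _ _ hp0.le]
            gcongr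
            exact (ENNReal.ofReal_le_ofReal (min_le_right _ _)).trans_eq
              (ENNReal.ofReal_natCast n)
        _ < ∞ := by
            rw [lintegral_const_mul _ (hfm.pow_const p)]
            exact ENNReal.mul_lt_top (ENNReal.rpow_lt_top_of_nonneg hp0.le (by simp)) hfin
    rw [mul_assoc]
    refine le_two_mul_of_le_add_half hT.ne ?_
    calc _ = (∫⁻ z in K, (ω n z * ‖weighted α f z‖ₑ) ^ p) +
          ∫⁻ z in Kᶜ, (ω n z * ‖weighted α f z‖ₑ) ^ p := (lintegral_add_compl _ hK).symm
      _ ≤ _ := by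
        refine add_le_add ?_ (h1.trans (by gcongr))
        rw [← lintegral_const_mul _ (hfm.pow_const p)]
        refine le_trans (setLIntegral_mono' hK fun z hz ↦ ?_) (setLIntegral_le_lintegral _ _)
        rw [← ENNReal.mul_rpow_of_nonneg _ _ hp0.le]
        gcongr
        refine ENNReal.ofReal_le_ofReal ((min_le_left _ _).trans ?_)
        have := hKρ hz
        rw [mem_closedBall_zero_iff] at this
        linarith
  refine le_of_tendsto' (lintegral_tendsto_of_tendsto_of_monotone
    (fun n ↦ (((hωm n).mul hfm).pow_const p).aemeasurable)
    (Filter.Eventually.of_forall fun z m n hmn ↦ ?_)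
    (Filter.Eventually.of_forall fun z ↦ ?_)) key
  · simp only [hωdef, Pi.mul_apply]
    gcongr
  · refine tendsto_const_nhds.congr' ?_
    obtain ⟨N, hN⟩ := exists_nat_ge (1 + ‖z‖)
    filter_upwards [Filter.eventually_ge_atTop N] with n hn
    simp only [hωdef, Pi.mul_apply]
    rw [min_eq_left (hN.trans (by exact_mod_cast hn))]

/-- Multiplication by `z` preserves the zeros, so the gain of one power of `|z|` can be iterated:
the `p`-th power of the norm of `z^k f` grows at most like `Q^k`. Mass of `f` at `|z| > r` with `r^p
≥ 2Q` would make it grow at least like `(2Q)^k`. -/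
lemma eq_zero_of_vanishing (hα : 0 < α) (hp : 1 < p) (ht : 2 ≤ t) (ht' : 6 / √α ≤ t)
    (hS : X.overlap α ≤ S) (hη : innerConst α p t * S ≤ 1 / 2)
    (hcov : Kᶜ ⊆ ⋃ l ∈ {l | l ∈ X.points ∧ α * (t + 1) ^ 2 < (X.mult l : ℝ)},
      Metric.ball l (X.radius α l - (t + 1)))
    (hK : MeasurableSet K) (hρ : 0 ≤ ρ) (hKρ : K ⊆ Metric.closedBall 0 ρ)
    {f : ℂ → ℂ} (hf : f ∈ space α p)
    (hf0 : ∀ l : X.points, ∀ k < X.mult l, iteratedDeriv k f l = 0) : f = 0 := by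
  have hp0 : 0 < p := by linarith
  set Q := 2 * ENNReal.ofReal (1 + ρ) ^ p
  set I := ∫⁻ z, ‖weighted α f z‖ₑ ^ p
  have hfin : I < ∞ := ((mem_space_iff hp0).1 hf).2
  have hQ0 : 0 < Q := ENNReal.mul_pos (by simp)
    (ENNReal.rpow_pos (by simp; linarith) ENNReal.ofReal_ne_top).ne'
  have hQt : Q < ∞ := ENNReal.mul_lt_top (by simp)
    (ENNReal.rpow_lt_top_of_nonneg hp0.le ENNReal.ofReal_ne_top)
  have hpow (k : ℕ) : (∀ l : X.points, ∀ j < X.mult l,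
        iteratedDeriv j (fun z ↦ f z * z ^ k) l = 0) ∧
      (fun z ↦ f z * z ^ k) ∈ space α p ∧
      ∫⁻ z, ‖weighted α (fun z ↦ f z * z ^ k) z‖ₑ ^ p ≤ Q ^ k * I := by
    have hd (k : ℕ) : Differentiable ℂ fun z ↦ f z * z ^ k := hf.1.mul (by fun_prop)
    induction k with
    | zero => exact ⟨by simpa using fun l hl ↦ hf0 ⟨l, hl⟩, by simpa using hf, by simp [I]⟩
    | succ k ih =>
      obtain ⟨h1, h2, h3⟩ := ih
      have h4 := lintegral_one_add_norm_mul_le hα hp ht ht' hS hη hcov hK hKρ h2 h1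
      have h5 : ∫⁻ z, ‖weighted α (fun z ↦ f z * z ^ (k + 1)) z‖ₑ ^ p ≤ Q ^ (k + 1) * I := by
        calc _ ≤ ∫⁻ z, (ENNReal.ofReal (1 + ‖z‖) *
              ‖weighted α (fun z ↦ f z * z ^ k) z‖ₑ) ^ p := by
              refine lintegral_mono fun z ↦ ENNReal.rpow_le_rpow ?_ hp0.le
              rw [enorm_weighted, enorm_weighted, pow_succ, ← mul_assoc, enorm_mul (_ * _) z,
                mul_right_comm, mul_comm]
              gcongr
              rw [← ofReal_norm]
              exact ENNReal.ofReal_le_ofReal (by linarith)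
          _ ≤ Q * (Q ^ k * I) := h4.trans (by gcongr)
          _ = _ := by ring
      refine ⟨fun l ↦ iteratedDeriv_mul_eq_zero hf.1 (by fun_prop) (hf0 l),
        (mem_space_iff hp0).2 ⟨hd _, h5.trans_lt ?_⟩, h5⟩
      exact ENNReal.mul_lt_top (ENNReal.pow_lt_top hQt) hfin
  -- The factor `4` suffices because `4^p ≥ 4 = 2 · 2`, where one `2` is the constant in `Q`.
  set r := 4 * (1 + ρ)
  have hE : MeasurableSet {z : ℂ | r < ‖z‖} := measurableSet_lt measurable_const measurable_norm
  have hrp : 2 * Q ≤ ENNReal.ofReal r ^ p := by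
    rw [ENNReal.ofReal_mul (by norm_num), ENNReal.mul_rpow_of_nonneg _ _ hp0.le, ← mul_assoc]
    gcongr
    calc (2 * 2 : ℝ≥0∞) = 4 ^ (1 : ℝ) := by norm_num
      _ ≤ 4 ^ p := ENNReal.rpow_le_rpow_of_exponent_le (by norm_num) hp.le
      _ = _ := by simp
  have hle (k : ℕ) : 2 ^ k * ∫⁻ z in {z : ℂ | r < ‖z‖}, ‖weighted α f z‖ₑ ^ p ≤ I := by
    have h1 : (2 * Q) ^ k * ∫⁻ z in {z : ℂ | r < ‖z‖}, ‖weighted α f z‖ₑ ^ p ≤ Q ^ k * I := by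
      refine le_trans ?_ (hpow k).2.2
      rw [← lintegral_const_mul' _ _ (ENNReal.pow_lt_top (ENNReal.mul_lt_top (by simp) hQt)).ne]
      refine (setLIntegral_mono' hE fun z hz ↦ ?_).trans (setLIntegral_le_lintegral _ _)
      rw [enorm_weighted, enorm_weighted, enorm_mul, enorm_pow, mul_right_comm, mul_comm,
        ENNReal.mul_rpow_of_nonneg _ (‖z‖ₑ ^ k) hp0.le]
      gcongr
      rw [← ENNReal.rpow_natCast ‖z‖ₑ, ← ENNReal.rpow_mul, mul_comm (k : ℝ), ENNReal.rpow_mul,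
        ENNReal.rpow_natCast]
      gcongr
      refine hrp.trans ?_
      gcongr
      rw [← ofReal_norm]
      exact ENNReal.ofReal_le_ofReal (le_of_lt hz)
    rw [mul_pow, mul_comm (2 ^ k), mul_assoc] at h1
    exact (ENNReal.mul_le_mul_iff_right (pow_ne_zero k hQ0.ne') (ENNReal.pow_lt_top hQt).ne).1 h1
  have hzero : ∫⁻ z in {z : ℂ | r < ‖z‖}, ‖weighted α f z‖ₑ ^ p = 0 := by
    by_contra hne
    have htend : Filter.Tendsto (fun k : ℕ ↦ (2 : ℝ≥0∞) ^ k *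
        ∫⁻ z in {z : ℂ | r < ‖z‖}, ‖weighted α f z‖ₑ ^ p) Filter.atTop (nhds (∞ *
        ∫⁻ z in {z : ℂ | r < ‖z‖}, ‖weighted α f z‖ₑ ^ p)) :=
      ENNReal.Tendsto.mul_const (ENNReal.tendsto_pow_atTop_nhds_top_iff.2 (by norm_num))
        (Or.inl (by simp))
    rw [ENNReal.top_mul hne] at htend
    exact absurd (le_of_tendsto' htend hle) (not_le.2 hfin)
  have hae : (fun z ↦ f z) =ᵐ[volume.restrict {z : ℂ | r < ‖z‖}] fun _ ↦ 0 := by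
    rw [lintegral_eq_zero_iff ((measurable_weighted α hf.1.continuous).pow_const p)] at hzero
    filter_upwards [hzero] with z hz
    simpa [ENNReal.rpow_eq_zero_iff, hp0, hp0.not_gt, weighted] using hz
  have hopen : IsOpen {z : ℂ | r < ‖z‖} := isOpen_lt continuous_const continuous_norm
  have heq := Measure.eqOn_open_of_ae_eq hae hopen hf.1.continuous.continuousOn continuousOn_const
  have hz₀ : ((r + 1 : ℝ) : ℂ) ∈ {z : ℂ | r < ‖z‖} := by
    have : 0 ≤ r + 1 := by positivity
    rw [Set.mem_ofPred_eq, Complex.norm_real, Real.norm_eq_abs, abs_of_nonneg this]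
    linarith
  exact AnalyticOnNhd.eq_of_eventuallyEq (fun z _ ↦ hf.1.analyticAt z)
    (fun z _ ↦ analyticAt_const) (heq.eventuallyEq_of_mem (hopen.mem_nhds hz₀))

end Uniqueness

end UniquenessSet

/-! ### A priori bound, completeness and finite-dimensional quotients. -/

section Completeness

open MeasureTheory

/-- Provides the multiplicity of the fictitious point at the origin whose inner disc swallows `K`.
-/
lemma exists_mult_closedBall_subset {α t ρ : ℝ} (hα : 0 < α) (ht : 0 ≤ t) (hρ : 0 ≤ ρ) :
    ∃ M : ℕ, t ≤ √(M / α) ∧ Metric.closedBall (0 : ℂ) ρ ⊆ Metric.ball 0 (√(M / α) - (t + 1)) := by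
  obtain ⟨M, hM⟩ := exists_nat_gt (α * (ρ + t + 1) ^ 2)
  have := lt_radius hα (by positivity) hM
  exact ⟨M, by linarith, Metric.closedBall_subset_ball (by linarith)⟩

/-- Inner estimates are summed over the covering discs off `K` and applied once at the origin on
`K`. The errors add up to the small constant times `S`, from the overlap, plus `1`, from the disc at
the origin, and are absorbed. -/
lemma norm_rpow_le_apriori {X : Divisor} {α p t ρ : ℝ} {S : ℝ≥0} {K : Set ℂ}
    (hα : 0 < α) (hp : 1 < p) (ht : 2 ≤ t) (ht' : 6 / √α ≤ t)
    (hS : X.overlap α ≤ S) (hη : 4 ^ (p - 1) * innerConst α p t * (S + 1) ≤ 1 / 2)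
    (hcov : Kᶜ ⊆ ⋃ l ∈ {l | l ∈ X.points ∧ α * (t + 1) ^ 2 < (X.mult l : ℝ)},
      Metric.ball l (X.radius α l - (t + 1)))
    (hK : MeasurableSet K) (hKρ : K ⊆ Metric.closedBall 0 ρ) {M : ℕ} (hM : t ≤ √(M / α))
    (hMρ : Metric.closedBall (0 : ℂ) ρ ⊆ Metric.ball 0 (√(M / α) - (t + 1)))
    {f : ℂ → ℂ} (hf : f ∈ space α p) :
    norm α p f ^ p ≤ 2 * (quotConst α p t *
      (∑' l : X.points, quotientNorm α p l (X.mult l) f ^ p + quotientNorm α p 0 M f ^ p)) := by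
  have hp0 : 0 < p := by linarith
  have hcount := X.countable_points
  have hm := (measurable_weighted α hf.1.continuous).pow_const p
  have hfin : norm α p f ^ p ≠ ∞ :=
    (ENNReal.rpow_lt_top_of_nonneg hp0.le (norm_lt_top hf).ne).ne
  refine le_two_mul_of_le_add_half hfin ?_
  set q := quotConst α p t with hq
  set e := 4 ^ (p - 1) * innerConst α p t
  have h1 : ∫⁻ z in Kᶜ, ‖weighted α f z‖ₑ ^ p ≤
      q * ∑' l : X.points, quotientNorm α p l (X.mult l) f ^ p + e * (S * norm α p f ^ p) := by
    calc _ ≤ _ := setLIntegral_compl_le_tsum hcov _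
      _ ≤ ∑' l : X.points, (q * quotientNorm α p l (X.mult l) f ^ p +
          e * ∫⁻ z in Metric.ball (l : ℂ) (X.radius α l), ‖weighted α f z‖ₑ ^ p) := by
          refine ENNReal.tsum_le_tsum fun l ↦ ?_
          split_ifs with h
          · obtain ⟨h1, h2⟩ := sqrt_mult_bounds hα ht ht'
              (by linarith [lt_radius hα (by linarith) h] : t ≤ √(X.mult l / α))
            exact setLIntegral_le_quotientNorm hα hp h1 h2 hf.1 l (by linarith)
          · exact zero_le
      _ ≤ _ := by
          rw [ENNReal.tsum_add, ENNReal.tsum_mul_left, ENNReal.tsum_mul_left, norm_rpow hp0]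
          gcongr
          exact tsum_setLIntegral_le (fun _ ↦ Metric.isOpen_ball.measurableSet)
            (fun z ↦ (X.tsum_indicator_le_overlap α z).trans hS) hm
  have h2 : ∫⁻ z in K, ‖weighted α f z‖ₑ ^ p ≤
      q * quotientNorm α p 0 M f ^ p + e * norm α p f ^ p := by
    obtain ⟨h1, h2⟩ := sqrt_mult_bounds hα ht ht' hM
    refine (lintegral_mono_set (hKρ.trans hMρ)).trans ((setLIntegral_le_quotientNorm hα hp h1 h2
      hf.1 0 (by linarith)).trans ?_)
    rw [norm_rpow hp0, hq, quotConst]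
    gcongr
    exact Measure.restrict_le_self
  calc norm α p f ^ p = (∫⁻ z in K, ‖weighted α f z‖ₑ ^ p) +
        ∫⁻ z in Kᶜ, ‖weighted α f z‖ₑ ^ p := by rw [norm_rpow hp0, lintegral_add_compl _ hK]
    _ ≤ _ := add_le_add h2 h1
    _ = q * (∑' l : X.points, quotientNorm α p l (X.mult l) f ^ p + quotientNorm α p 0 M f ^ p) +
        e * (S + 1) * norm α p f ^ p := by ring
    _ ≤ _ := by gcongr

lemma exists_enorm_le_norm {α p : ℝ} (hα : 0 < α) (hp : 1 < p) (ρ : ℝ) :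
    ∃ c : ℝ≥0, ∀ f ∈ space α p, ∀ z : ℂ, ‖z‖ ≤ ρ → ‖f z‖ₑ ≤ c * norm α p f := by
  have hp0 : 0 < p := by linarith
  have hfin : evalConst α p ^ p⁻¹ * ENNReal.ofReal (Real.exp (α * ρ ^ 2 / 2)) ≠ ∞ :=
    ENNReal.mul_ne_top (ENNReal.rpow_lt_top_of_nonneg (by positivity)
      (evalConst_lt_top α hp).ne).ne ENNReal.ofReal_ne_top
  refine ⟨(evalConst α p ^ p⁻¹ * ENNReal.ofReal (Real.exp (α * ρ ^ 2 / 2))).toNNReal,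
    fun f hf z hz ↦ ?_⟩
  rw [ENNReal.coe_toNNReal hfin]
  have h := ENNReal.rpow_le_rpow (enorm_weighted_rpow_le hα hp hf.1 z) (inv_nonneg.2 hp0.le)
  rw [ENNReal.mul_rpow_of_nonneg _ _ (inv_nonneg.2 hp0.le), ← ENNReal.rpow_mul,
    ← ENNReal.rpow_mul, mul_inv_cancel₀ hp0.ne', ENNReal.rpow_one, ENNReal.rpow_one] at h
  calc ‖f z‖ₑ = ‖weighted α f z‖ₑ * ENNReal.ofReal (Real.exp (α * ‖z‖ ^ 2 / 2)) := by
        rw [enorm_weighted, mul_assoc, ← ENNReal.ofReal_mul (Real.exp_pos _).le, ← Real.exp_add]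
        ring_nf; simp
    _ ≤ evalConst α p ^ p⁻¹ * norm α p f * ENNReal.ofReal (Real.exp (α * ρ ^ 2 / 2)) := by
        gcongr
    _ = _ := by ring

lemma exists_enorm_iteratedDeriv_le {α p : ℝ} (hα : 0 < α) (hp : 1 < p) (l : ℂ) (k : ℕ) :
    ∃ c : ℝ≥0, ∀ f ∈ space α p, ‖iteratedDeriv k f l‖ₑ ≤ c * norm α p f := by
  obtain ⟨c, hc⟩ := exists_enorm_le_norm hα hp (‖l‖ + 1)
  refine ⟨k.factorial * c, fun f hf ↦ ?_⟩
  have hN := (norm_lt_top hf).ne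
  lift norm α p f to ℝ≥0 using hN with N hNe
  have h := Complex.norm_iteratedDeriv_le_of_forall_mem_sphere_norm_le (c := l) (R := 1)
    (C := (c * N : ℝ≥0)) k one_pos hf.1.diffContOnCl fun z hz ↦ by
      have hz' : ‖z‖ ≤ ‖l‖ + 1 := by
        rw [mem_sphere_iff_norm] at hz
        linarith [norm_le_norm_add_norm_sub' z l]
      have := hc f hf z hz'
      rw [← hNe] at this
      exact_mod_cast this
  rw [one_pow, div_one] at h
  rw [← ENNReal.coe_mul, enorm_le_coe, ← NNReal.coe_le_coe, coe_nnnorm]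
  refine h.trans_eq ?_
  push_cast
  ring

/-- Bounded point evaluations give a locally uniform, hence entire, limit; Fatou's lemma gives
convergence in norm. -/
lemma exists_lim_of_cauchy {α p : ℝ} (hα : 0 < α) (hp : 1 < p) {F : ℕ → ℂ → ℂ}
    (hF : ∀ n, F n ∈ space α p)
    (hC : ∀ ε : ℝ≥0, 0 < ε → ∃ N, ∀ n ≥ N, ∀ m ≥ N, norm α p (F n - F m) ≤ ε) :
    ∃ f ∈ space α p, ∀ ε : ℝ≥0, 0 < ε → ∃ N, ∀ n ≥ N, norm α p (F n - f) ≤ ε := by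
  have hp0 : 0 < p := by linarith
  have hu (ρ : ℝ) : UniformCauchySeqOn F Filter.atTop (Metric.closedBall 0 ρ) := by
    obtain ⟨c, hc⟩ := exists_enorm_le_norm hα hp ρ
    rw [Metric.uniformCauchySeqOn_iff]
    intro ε hε
    obtain ⟨N, hN⟩ := hC (Real.toNNReal (ε / (2 * (c + 1)))) (by simp; positivity)
    refine ⟨N, fun n hn m hm z hz ↦ ?_⟩
    have h1 := hc _ (sub_mem_space (hF n) (hF m)) z (by simpa using hz)
    have h2 := h1.trans (mul_le_mul_right (hN n hn m hm) _)
    rw [dist_eq_norm]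
    have h3 : ‖F n z - F m z‖ ≤ c * (ε / (2 * (c + 1))) := by
      have : ‖F n z - F m z‖₊ ≤ c * Real.toNNReal (ε / (2 * (c + 1))) := by exact_mod_cast h2
      have := NNReal.coe_le_coe.2 this
      rwa [NNReal.coe_mul, Real.coe_toNNReal _ (by positivity), coe_nnnorm] at this
    refine h3.trans_lt ?_
    rw [← mul_div_assoc, div_lt_iff₀ (by positivity)]
    nlinarith [c.2, mul_nonneg c.2 hε.le]
  have hlim (z : ℂ) : ∃ w, Filter.Tendsto (fun n ↦ F n z) Filter.atTop (nhds w) :=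
    cauchySeq_tendsto_of_complete ((hu ‖z‖).cauchySeq (by simp))
  choose f hf using hlim
  have hunif (ρ : ℝ) : TendstoUniformlyOn F f Filter.atTop (Metric.closedBall 0 ρ) :=
    (hu ρ).tendstoUniformlyOn_of_tendsto fun z _ ↦ hf z
  have hloc : TendstoLocallyUniformlyOn F f Filter.atTop Set.univ := by
    rw [tendstoLocallyUniformlyOn_iff_forall_isCompact isOpen_univ]
    intro K _ hK
    obtain ⟨ρ, hρ⟩ := hK.isBounded.subset_closedBall 0
    exact (hunif ρ).mono hρ
  have hd : Differentiable ℂ f := differentiableOn_univ.1 (hloc.differentiableOn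
    (Filter.Eventually.of_forall fun n ↦ (hF n).1.differentiableOn) isOpen_univ)
  have hlimle (ε : ℝ≥0) (hε : 0 < ε) : ∃ N, ∀ n ≥ N, norm α p (F n - f) ≤ ε := by
    obtain ⟨N, hN⟩ := hC ε hε
    refine ⟨N, fun n hn ↦ ?_⟩
    rw [← ENNReal.rpow_le_rpow_iff hp0, norm_rpow hp0]
    have hpt (z : ℂ) : Filter.Tendsto (fun m ↦ ‖weighted α (F n - F m) z‖ₑ ^ p) Filter.atTop
        (nhds (‖weighted α (F n - f) z‖ₑ ^ p)) := by
      refine (ENNReal.continuous_rpow_const.tendsto _).comp ((continuous_enorm.tendsto _).comp ?_)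
      simp only [weighted, Pi.sub_apply]
      exact (tendsto_const_nhds.sub (hf z)).mul_const _
    calc _ = ∫⁻ z, Filter.liminf (fun m ↦ ‖weighted α (F n - F m) z‖ₑ ^ p) Filter.atTop :=
          lintegral_congr fun z ↦ (hpt z).liminf_eq.symm
      _ ≤ _ := lintegral_liminf_le fun m ↦
          (measurable_weighted α ((hF n).1.sub (hF m).1).continuous).pow_const p
      _ ≤ _ := by
          refine Filter.liminf_le_of_frequently_le' ?_
          refine Filter.Eventually.frequently ?_
          filter_upwards [Filter.eventually_ge_atTop N] with m hm
          rw [← norm_rpow hp0]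
          exact ENNReal.rpow_le_rpow (hN n hn m hm) hp0.le
  refine ⟨f, ?_, hlimle⟩
  obtain ⟨N, hN⟩ := hlimle 1 one_pos
  have h1 : F N - f ∈ space α p := by
    refine (mem_space_iff hp0).2 ⟨(hF N).1.sub hd, ?_⟩
    rw [← norm_rpow hp0]
    exact ENNReal.rpow_lt_top_of_nonneg hp0.le ((hN N le_rfl).trans_lt ENNReal.coe_lt_top).ne
  simpa using sub_mem_space (hF N) h1

lemma weighted_smul (α : ℝ) (c : ℂ) (f : ℂ → ℂ) (z : ℂ) :
    weighted α (c • f) z = c * weighted α f z := by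
  simp [weighted, mul_assoc]

lemma norm_smul (α : ℝ) {p : ℝ} (c : ℂ) (f : ℂ → ℂ) :
    norm α p (c • f) = ‖c‖ₑ * norm α p f := by
  have : weighted α (c • f) = c • weighted α f := funext (weighted_smul α c f)
  rw [norm, this, eLpNorm_const_smul, norm]

lemma smul_mem_space {α p : ℝ} {f : ℂ → ℂ} (hf : f ∈ space α p) (c : ℂ) : c • f ∈ space α p := by
  refine ⟨hf.1.const_smul c, ?_⟩
  have : weighted α (c • f) = c • weighted α f := funext (weighted_smul α c f)
  rw [this]
  exact hf.2.const_smul c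

lemma quotientNorm_smul_rpow_le {α p : ℝ} (hp : 0 < p) (l : ℂ) (m : ℕ) (c : ℂ) (f : ℂ → ℂ) :
    quotientNorm α p l m (c • f) ^ p ≤ ‖c‖ₑ ^ p * quotientNorm α p l m f ^ p := by
  have h := le_mul_quotientNorm_rpow_add (α := α) hp (l := l) (m := m) (f := f)
    (X := quotientNorm α p l m (c • f) ^ p) (A := ‖c‖ₑ ^ p) (Y := 0)
    (ENNReal.rpow_lt_top_of_nonneg hp.le (by simp)).ne fun g hg ↦ by
      rw [add_zero, ← ENNReal.mul_rpow_of_nonneg _ _ hp.le, ← norm_smul, smul_sub]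
      refine ENNReal.rpow_le_rpow (iInf₂_le (c • g) ⟨smul_mem_space hg.1 c, fun k hk ↦ ?_⟩) hp.le
      rw [iteratedDeriv_const_smul_field, hg.2 k hk]; simp
  rwa [add_zero] at h

lemma quotientNorm_sub_rpow_le {α p : ℝ} (hp : 1 ≤ p) {l : ℂ} {m : ℕ} {f g : ℂ → ℂ}
    (hf : Differentiable ℂ f) :
    quotientNorm α p l m (f - g) ^ p ≤
      2 ^ (p - 1) * quotientNorm α p l m f ^ p + 2 ^ (p - 1) * quotientNorm α p l m g ^ p := by
  have hp0 : 0 < p := by linarith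
  have ht : (2 : ℝ≥0∞) ^ (p - 1) ≠ ∞ := (ENNReal.rpow_lt_top_of_nonneg (by linarith) (by simp)).ne
  refine le_mul_quotientNorm_rpow_add hp0 ht fun u hu ↦ ?_
  rw [add_comm]
  refine le_mul_quotientNorm_rpow_add hp0 ht fun v hv ↦ ?_
  have h1 : quotientNorm α p l m (f - g) ≤ norm α p ((f - u) + (v - g)) := by
    have hmem : u - v ∈ vanishing α p l m := by
      refine ⟨sub_mem_space hu.1 hv.1, fun k hk ↦ ?_⟩
      rw [iteratedDeriv_sub hu.1.1.contDiff.contDiffAt hv.1.1.contDiff.contDiffAt, hu.2 k hk,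
        hv.2 k hk, sub_zero]
    refine (iInf₂_le (u - v) hmem).trans_eq ?_
    congr 1; ring
  refine (ENNReal.rpow_le_rpow h1 hp0.le).trans ?_
  have h2 := setLIntegral_weighted_add_le (α := α) hp (f := f - u) (g := v - g)
    (hf.sub hu.1.1).continuous Set.univ
  simp only [Measure.restrict_univ, ← norm_rpow hp0] at h2
  refine h2.trans_eq ?_
  have : norm α p (v - g) = norm α p (g - v) := by
    rw [show v - g = (-1 : ℂ) • (g - v) by simp, norm_smul]; simp
  rw [this]; ring

lemma quotientNorm_le_norm {α p : ℝ} (l : ℂ) (m : ℕ) (f : ℂ → ℂ) :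
    quotientNorm α p l m f ≤ norm α p f := by
  refine (iInf₂_le (0 : ℂ → ℂ) ⟨zero_mem_space α p, fun k _ ↦ ?_⟩).trans_eq (by rw [sub_zero])
  rw [show (0 : ℂ → ℂ) = fun _ ↦ 0 from rfl, iteratedDeriv_const]; simp

/-- Half of the Gaussian exponent bounds the power, the other half is integrable. -/
lemma pow_mem_space {α p : ℝ} (hα : 0 < α) (hp : 0 < p) (k : ℕ) :
    (fun z : ℂ ↦ z ^ k) ∈ space α p := by
  refine (mem_space_iff hp).2 ⟨by fun_prop, ?_⟩
  have hα2 : 0 < α / 2 := by positivity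
  set d := |k - α / 2| / √(α / 2)
  set c := Real.exp (d ^ 2 / 2) * Real.exp (-(α / 2) * 1 ^ 2 / 2)
  have h (z : ℂ) : ‖weighted α (fun z ↦ z ^ k) z‖ₑ ^ p ≤
      ENNReal.ofReal c ^ p * gauss (α / 2) p z := by
    rw [gauss, ← ENNReal.mul_rpow_of_nonneg _ _ hp.le, enorm_weighted]
    refine ENNReal.rpow_le_rpow ?_ hp.le
    have h1 := pow_mul_exp_le hα2 (norm_nonneg z) one_pos k (d := d) (by
      rw [one_pow, mul_one, mul_one, div_mul_cancel₀]
      exact (Real.sqrt_pos.2 hα2).ne')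
    rw [← ofReal_norm, ← ENNReal.ofReal_mul (norm_nonneg _), ← ENNReal.ofReal_mul (by positivity)]
    refine ENNReal.ofReal_le_ofReal ?_
    have e : Real.exp (-α * ‖z‖ ^ 2 / 2) =
        Real.exp (-(α / 2) * ‖z‖ ^ 2 / 2) * Real.exp (-(α / 2) * ‖z‖ ^ 2 / 2) := by
      rw [← Real.exp_add]; ring_nf
    rw [e, norm_pow, ← mul_assoc]
    rw [div_one] at h1
    gcongr
  refine (lintegral_mono h).trans_lt ?_
  rw [lintegral_const_mul _ (measurable_gauss _ _)]
  exact ENNReal.mul_lt_top (ENNReal.rpow_lt_top_of_nonneg hp.le ENNReal.ofReal_ne_top)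
    (lintegral_gauss_lt_top hα2 hp)

lemma taylorPoly_mem_space {α p : ℝ} (hα : 0 < α) (hp : 0 < p) (f : ℂ → ℂ) (M : ℕ) :
    taylorPoly f M ∈ space α p := by
  have e : taylorPoly f M = ∑ k ∈ Finset.range M,
      (iteratedDeriv k f 0 / k.factorial) • fun z : ℂ ↦ z ^ k := by
    ext z; simp [taylorPoly]
  rw [e]
  refine Finset.sum_induction _ (· ∈ space α p) (fun _ _ ↦ add_mem_space) (zero_mem_space α p)
    fun k _ ↦ smul_mem_space (pow_mem_space hα hp k) _

/-- The quotient norm at the origin is controlled by the Taylor coefficients. -/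
lemma exists_quotientNorm_zero_le {α p : ℝ} (hα : 0 < α) (hp : 1 < p) (M : ℕ) :
    ∃ c : ℝ≥0, ∀ f ∈ space α p, quotientNorm α p 0 M f ≤
      c * ‖fun k : Fin M ↦ iteratedDeriv k f 0‖ₑ := by
  have hp0 : 0 < p := by linarith
  refine ⟨∑ k ∈ Finset.range M, (norm α p fun z : ℂ ↦ z ^ k).toNNReal, fun f hf ↦ ?_⟩
  have hT := taylorPoly_mem_space (α := α) (p := p) hα hp0 f M
  have h1 : quotientNorm α p 0 M f ≤ norm α p (taylorPoly f M) := by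
    have hmem : f - taylorPoly f M ∈ vanishing α p 0 M := by
      refine ⟨sub_mem_space hf hT, fun k hk ↦ ?_⟩
      rw [iteratedDeriv_sub hf.1.contDiff.contDiffAt hT.1.contDiff.contDiffAt,
        iteratedDeriv_taylorPoly hk, sub_self]
    refine (iInf₂_le (f - taylorPoly f M) hmem).trans_eq ?_
    rw [sub_sub_cancel]
  refine h1.trans ?_
  have e : weighted α (taylorPoly f M) = ∑ k ∈ Finset.range M,
      (iteratedDeriv k f 0 / k.factorial) • weighted α fun z : ℂ ↦ z ^ k := by
    ext z
    simp only [weighted, taylorPoly, Finset.sum_apply, Pi.smul_apply, smul_eq_mul, Finset.sum_mul]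
    exact Finset.sum_congr rfl fun k _ ↦ by ring
  rw [norm, e]
  refine (eLpNorm_sum_le (fun k _ ↦ ((pow_mem_space hα hp0 k).2.const_smul _).1)
    (by rw [← ENNReal.ofReal_one]; exact ENNReal.ofReal_le_ofReal hp.le)).trans ?_
  rw [ENNReal.ofNNReal_finsetSum, Finset.sum_mul]
  refine Finset.sum_le_sum fun k hk ↦ ?_
  rw [eLpNorm_const_smul, ENNReal.coe_toNNReal (norm_lt_top (pow_mem_space hα hp0 k)).ne, mul_comm]
  refine mul_le_mul_right ?_ _
  rw [← ofReal_norm, ← ofReal_norm]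
  refine ENNReal.ofReal_le_ofReal ?_
  rw [norm_div, Complex.norm_natCast]
  refine (div_le_self (norm_nonneg _) (by exact_mod_cast k.factorial_pos)).trans ?_
  exact norm_le_pi_norm (fun k : Fin M ↦ iteratedDeriv k f 0) ⟨k, Finset.mem_range.1 hk⟩

end Completeness

/-! ### The two sampling inequalities. -/

section Sufficiency

open MeasureTheory

lemma exists_normalized {X : Divisor} {α p : ℝ} (hp : 0 < p)
    (h : ¬ ∃ A : ℝ≥0, 0 < A ∧ ∀ f ∈ space α p,
      A * norm α p f ^ p ≤ ∑' l : X.points, quotientNorm α p l (X.mult l) f ^ p)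
    {A : ℝ≥0} (hA : 0 < A) :
    ∃ f ∈ space α p, norm α p f = 1 ∧
      ∑' l : X.points, quotientNorm α p l (X.mult l) f ^ p ≤ A := by
  push Not at h
  obtain ⟨f, hf, hlt⟩ := h A hA
  have hN : norm α p f ≠ ∞ := (norm_lt_top hf).ne
  have hN0 : norm α p f ≠ 0 := fun h0 ↦ by
    rw [h0, ENNReal.zero_rpow_of_pos hp, mul_zero] at hlt
    exact not_lt_zero hlt
  set c : ℂ := (((norm α p f).toReal⁻¹ : ℝ) : ℂ)
  have hc : ‖c‖ₑ * norm α p f = 1 := by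
    have : ‖c‖ₑ = (norm α p f)⁻¹ := by
      rw [← ofReal_norm, Complex.norm_real, Real.norm_eq_abs, abs_of_nonneg (by positivity),
        ENNReal.ofReal_inv_of_pos (ENNReal.toReal_pos hN0 hN), ENNReal.ofReal_toReal hN]
    rw [this, ENNReal.inv_mul_cancel hN0 hN]
  refine ⟨c • f, smul_mem_space hf c, by rw [norm_smul, hc], ?_⟩
  calc _ ≤ ∑' l : X.points, ‖c‖ₑ ^ p * quotientNorm α p l (X.mult l) f ^ p :=
        ENNReal.tsum_le_tsum fun l ↦ quotientNorm_smul_rpow_le hp _ _ _ _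
    _ ≤ ‖c‖ₑ ^ p * (A * norm α p f ^ p) := by
        rw [ENNReal.tsum_mul_left]
        gcongr
    _ = A * (‖c‖ₑ * norm α p f) ^ p := by rw [ENNReal.mul_rpow_of_nonneg _ _ hp.le]; ring
    _ = _ := by rw [hc, ENNReal.one_rpow, mul_one]

/-- Derivatives at `l` of order less than `m` are continuous functionals that factor through the
quotient. -/
lemma iteratedDeriv_eq_zero_of_quotientNorm_eq_zero {α p : ℝ} (hα : 0 < α) (hp : 1 < p) {l : ℂ}
    {m : ℕ} {f : ℂ → ℂ} (hf : f ∈ space α p) (h : quotientNorm α p l m f = 0) :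
    ∀ k < m, iteratedDeriv k f l = 0 := by
  have hp0 : 0 < p := by linarith
  intro k hk
  obtain ⟨c, hc⟩ := exists_enorm_iteratedDeriv_le hα hp l k
  have h1 := le_mul_quotientNorm_rpow_add (α := α) hp0 (l := l) (m := m) (f := f)
    (X := ‖iteratedDeriv k f l‖ₑ ^ p) (A := (c : ℝ≥0∞) ^ p) (Y := 0)
    (ENNReal.rpow_lt_top_of_nonneg hp0.le ENNReal.coe_ne_top).ne fun g hg ↦ by
      rw [add_zero, ← ENNReal.mul_rpow_of_nonneg _ _ hp0.le]
      have := hc _ (sub_mem_space hf hg.1)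
      rw [iteratedDeriv_sub hf.1.contDiff.contDiffAt hg.1.1.contDiff.contDiffAt, hg.2 k hk,
        sub_zero] at this
      exact ENNReal.rpow_le_rpow this hp0.le
  rw [h, ENNReal.zero_rpow_of_pos hp0, mul_zero, zero_add, nonpos_iff_eq_zero,
    ENNReal.rpow_eq_zero_iff_of_pos hp0] at h1
  simpa using h1

/-- The quotient at the origin is controlled by `M` Taylor coefficients, which stay bounded along
the sequence, so Bolzano–Weierstrass applies. -/
lemma exists_subseq_cauchy {α p : ℝ} (hα : 0 < α) (hp : 1 < p) (M : ℕ) {F : ℕ → ℂ → ℂ}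
    (hF : ∀ n, F n ∈ space α p) (hF1 : ∀ n, norm α p (F n) = 1) :
    ∃ φ : ℕ → ℕ, StrictMono φ ∧ ∀ ε : ℝ≥0, 0 < ε → ∃ N, ∀ n ≥ N, ∀ m ≥ N,
      quotientNorm α p 0 M (F (φ n) - F (φ m)) ≤ ε := by
  choose c hc using fun k : ℕ ↦ exists_enorm_iteratedDeriv_le hα hp 0 k
  set a : ℕ → Fin M → ℂ := fun n k ↦ iteratedDeriv k (F n) 0
  have hbdd (n : ℕ) : a n ∈ Set.univ.pi fun k : Fin M ↦ Metric.closedBall (0 : ℂ) (c k) :=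
    fun k _ ↦ by
      have := hc k _ (hF n)
      rw [hF1, mul_one, enorm_le_coe] at this
      rw [mem_closedBall_zero_iff]
      exact_mod_cast this
  obtain ⟨b, -, φ, hφ, hlim⟩ := tendsto_subseq_of_bounded
    (Bornology.IsBounded.pi fun k ↦ Metric.isBounded_closedBall) hbdd
  obtain ⟨C, hC⟩ := exists_quotientNorm_zero_le hα hp M
  refine ⟨φ, hφ, fun ε hε ↦ ?_⟩
  have hcs := Metric.cauchySeq_iff.1 hlim.cauchySeq (ε / (C + 1)) (by positivity)
  obtain ⟨N, hN⟩ := hcs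
  refine ⟨N, fun n hn m hm ↦ (hC _ (sub_mem_space (hF _) (hF _))).trans ?_⟩
  have h1 := hN n hn m hm
  have e : (fun k : Fin M ↦ iteratedDeriv k (F (φ n) - F (φ m)) 0) = a (φ n) - a (φ m) := by
    ext k
    rw [iteratedDeriv_sub (hF _).1.contDiff.contDiffAt (hF _).1.contDiff.contDiffAt]
    rfl
  rw [e]
  rw [dist_eq_norm] at h1
  have h2 : ‖a (φ n) - a (φ m)‖₊ ≤ ε / (C + 1) := by
    rw [← NNReal.coe_le_coe]; push_cast; exact h1.le
  have h3 : C * ‖a (φ n) - a (φ m)‖₊ ≤ ε := by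
    calc _ ≤ (C + 1) * (ε / (C + 1)) := by gcongr; simp
      _ = ε := by field_simp
  rw [enorm_eq_nnnorm]
  exact_mod_cast h3

/-- If the bound fails, there are unit vectors whose sampling sums tend to zero. Along a subsequence
the term at the origin is Cauchy, so by the a priori bound the functions converge in norm. The limit
vanishes on `X`, hence is zero, although the norms equal one. -/
lemma exists_lower_bound {X : Divisor} {α p t ρ : ℝ} {S : ℝ≥0} {K : Set ℂ}
    (hα : 0 < α) (hp : 1 < p) (ht : 2 ≤ t) (ht' : 6 / √α ≤ t)
    (hS : X.overlap α ≤ S) (hη : 4 ^ (p - 1) * innerConst α p t * (S + 1) ≤ 1 / 2)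
    (hcov : Kᶜ ⊆ ⋃ l ∈ {l | l ∈ X.points ∧ α * (t + 1) ^ 2 < (X.mult l : ℝ)},
      Metric.ball l (X.radius α l - (t + 1)))
    (hK : MeasurableSet K) (hρ : 0 ≤ ρ) (hKρ : K ⊆ Metric.closedBall 0 ρ) :
    ∃ A : ℝ≥0, 0 < A ∧ ∀ f ∈ space α p,
      A * norm α p f ^ p ≤ ∑' l : X.points, quotientNorm α p l (X.mult l) f ^ p := by
  by_contra hno
  have hp0 : 0 < p := by linarith
  choose F hF hF1 hFq using fun n : ℕ ↦ exists_normalized hp0 hno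
    (A := 1 / ((n : ℝ≥0) + 1)) (by positivity)
  obtain ⟨M, hM, hMρ⟩ := exists_mult_closedBall_subset hα (by linarith : 0 ≤ t) hρ
  obtain ⟨φ, hφ, hcauchy⟩ := exists_subseq_cauchy hα hp M hF hF1
  have h2t : (2 : ℝ≥0∞) ^ (p - 1) < ∞ := ENNReal.rpow_lt_top_of_nonneg (by linarith) (by simp)
  have hqt := quotConst_lt_top α hp (by linarith : 1 ≤ t)
  have htendsto : Filter.Tendsto (fun n : ℕ ↦ ((1 / ((n : ℝ≥0) + 1) : ℝ≥0) : ℝ≥0∞))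
      Filter.atTop (nhds 0) := by
    rw [← ENNReal.coe_zero, ENNReal.tendsto_coe]
    exact tendsto_one_div_add_atTop_nhds_zero_nat
  have hFφ : Filter.Tendsto (fun n : ℕ ↦ ((1 / ((φ n : ℝ≥0) + 1) : ℝ≥0) : ℝ≥0∞))
      Filter.atTop (nhds 0) := htendsto.comp hφ.tendsto_atTop
  have hC : ∀ ε : ℝ≥0, 0 < ε → ∃ N, ∀ n ≥ N, ∀ m ≥ N,
      norm α p (F (φ n) - F (φ m)) ≤ ε := by
    intro ε hε
    have hεp : 0 < (ε : ℝ≥0∞) ^ p := ENNReal.rpow_pos (by exact_mod_cast hε) ENNReal.coe_ne_top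
    -- This is the constant of the a priori bound times `2^(p-1) + 2^(p-1) + 1`: two sampling sums
    -- and the term at the origin, each at most `δ`.
    set D := 2 * quotConst α p t * (2 * 2 ^ (p - 1) + 1)
    have hD : D < ∞ := by finiteness
    have hD0 : D ≠ 0 := by
      simp only [D, quotConst]
      have : (2 : ℝ≥0∞) ^ (p - 1) ≠ 0 := (ENNReal.rpow_pos (by simp) (by simp)).ne'
      simp [this]
    obtain ⟨δ, hδ0, hδ⟩ : ∃ δ : ℝ≥0, 0 < δ ∧ D * (δ : ℝ≥0∞) ≤ (ε : ℝ≥0∞) ^ p := by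
      obtain ⟨δ, h0, h1⟩ := ENNReal.lt_iff_exists_nnreal_btwn.1
        (ENNReal.div_pos hεp.ne' hD.ne)
      refine ⟨δ, by exact_mod_cast h0, ?_⟩
      calc D * δ ≤ D * ((ε : ℝ≥0∞) ^ p / D) := by gcongr
        _ = _ := ENNReal.mul_div_cancel hD0 hD.ne
    have hδp : 0 < δ ^ p⁻¹ := NNReal.rpow_pos hδ0
    obtain ⟨N₁, hN₁⟩ := hcauchy (δ ^ p⁻¹) hδp
    obtain ⟨N₂, hN₂⟩ := Filter.eventually_atTop.1 (hFφ.eventually_le_const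
      (by exact_mod_cast hδ0 : (0 : ℝ≥0∞) < δ))
    refine ⟨max N₁ N₂, fun n hn m hm ↦ ?_⟩
    rw [← ENNReal.rpow_le_rpow_iff hp0]
    refine le_trans ?_ hδ
    refine (norm_rpow_le_apriori hα hp ht ht' hS hη hcov hK hKρ hM hMρ
      (sub_mem_space (hF _) (hF _))).trans ?_
    have hq1 : quotientNorm α p 0 M (F (φ n) - F (φ m)) ^ p ≤ δ := by
      refine (ENNReal.rpow_le_rpow (hN₁ n (le_of_max_le_left hn) m (le_of_max_le_left hm))
        hp0.le).trans_eq ?_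
      rw [← ENNReal.coe_rpow_of_nonneg _ hp0.le, ← NNReal.rpow_mul, inv_mul_cancel₀ hp0.ne',
        NNReal.rpow_one]
    have hq2 : ∑' l : X.points, quotientNorm α p l (X.mult l) (F (φ n) - F (φ m)) ^ p ≤
        2 ^ (p - 1) * δ + 2 ^ (p - 1) * δ := by
      refine (ENNReal.tsum_le_tsum fun l ↦ quotientNorm_sub_rpow_le hp.le (hF _).1).trans ?_
      rw [ENNReal.tsum_add, ENNReal.tsum_mul_left, ENNReal.tsum_mul_left]
      gcongr
      · exact (hFq _).trans (hN₂ n (le_of_max_le_right hn))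
      · exact (hFq _).trans (hN₂ m (le_of_max_le_right hm))
    calc _ ≤ 2 * (quotConst α p t * (2 ^ (p - 1) * δ + 2 ^ (p - 1) * δ + δ)) := by gcongr
      _ = D * δ := by ring
  obtain ⟨f, hf, hlim⟩ := exists_lim_of_cauchy hα hp (fun n ↦ hF (φ n)) hC
  have hlim0 : Filter.Tendsto (fun n ↦ norm α p (F (φ n) - f)) Filter.atTop (nhds 0) := by
    rw [ENNReal.tendsto_nhds_zero]
    intro ε hε
    obtain ⟨δ, h0, h1⟩ := ENNReal.lt_iff_exists_nnreal_btwn.1 hε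
    obtain ⟨N, hN⟩ := hlim δ (by exact_mod_cast h0)
    exact Filter.eventually_atTop.2 ⟨N, fun n hn ↦ (hN n hn).trans h1.le⟩
  have hq0 (l : X.points) : quotientNorm α p l (X.mult l) f = 0 := by
    have hle (n : ℕ) : quotientNorm α p l (X.mult l) f ^ p ≤
        2 ^ (p - 1) * ((1 / ((φ n : ℝ≥0) + 1) : ℝ≥0) : ℝ≥0∞) +
        2 ^ (p - 1) * norm α p (F (φ n) - f) ^ p := by
      have h1 := quotientNorm_sub_rpow_le (α := α) hp.le (l := l) (m := X.mult l) (f := F (φ n))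
        (g := F (φ n) - f) (hF _).1
      rw [sub_sub_cancel] at h1
      refine h1.trans ?_
      gcongr
      · exact (ENNReal.le_tsum l).trans (hFq (φ n))
      · exact quotientNorm_le_norm _ _ _
    have hl1 := ENNReal.Tendsto.const_mul (a := (2 : ℝ≥0∞) ^ (p - 1)) hFφ (Or.inr h2t.ne)
    have hl2 := ENNReal.Tendsto.const_mul (a := (2 : ℝ≥0∞) ^ (p - 1))
      ((ENNReal.continuous_rpow_const (y := p)).tendsto _ |>.comp hlim0) (Or.inr h2t.ne)
    have h0 := ge_of_tendsto' (hl1.add hl2) hle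
    rw [ENNReal.zero_rpow_of_pos hp0, mul_zero, add_zero, nonpos_iff_eq_zero,
      ENNReal.rpow_eq_zero_iff_of_pos hp0] at h0
    exact h0
  have hη' : innerConst α p t * S ≤ 1 / 2 := by
    refine le_trans ?_ hη
    have h4 : (1 : ℝ≥0∞) ≤ 4 ^ (p - 1) := ENNReal.one_le_rpow (by norm_num) (by linarith)
    gcongr
    · exact le_mul_of_one_le_left' h4
    · exact le_self_add
  have hf0 := eq_zero_of_vanishing hα hp ht ht' hS hη' hcov hK hρ hKρ hf fun l ↦
    iteratedDeriv_eq_zero_of_quotientNorm_eq_zero hα hp hf (hq0 l)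
  simp only [hf0, sub_zero, hF1] at hlim0
  exact one_ne_zero (tendsto_nhds_unique tendsto_const_nhds hlim0)

lemma Divisor.exists_upper_bound {X : Divisor} {α p : ℝ} (hα : 0 < α) (hp : 1 < p)
    (hX : X.FiniteOverlap α) :
    ∃ B : ℝ≥0, 0 < B ∧ ∀ f ∈ space α p,
      ∑' l : X.points, quotientNorm α p l (X.mult l) f ^ p ≤ B * norm α p f ^ p := by
  have hcount := X.countable_points
  have hfin : outerConst α p * (overlapFactor α * X.overlap α) < ∞ :=
    ENNReal.mul_lt_top (outerConst_lt_top α hp) (ENNReal.mul_lt_top (overlapFactor_lt_top hα) hX)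
  refine ⟨(outerConst α p * (overlapFactor α * X.overlap α)).toNNReal + 1, by positivity,
    fun f hf ↦ ?_⟩
  rw [ENNReal.coe_add, ENNReal.coe_toNNReal hfin.ne]
  refine (X.tsum_quotientNorm_le hα hp hf).trans (le_trans ?_ (mul_le_mul_left le_self_add _))
  rw [mul_assoc, norm_rpow (by linarith)]
  gcongr
  exact tsum_setLIntegral_le (fun _ ↦ Metric.isOpen_ball.measurableSet)
    (X.tsum_indicator_enlarge_le hα)
    ((measurable_weighted α hf.1.continuous).pow_const p)

end Sufficiency

end Fock

end

theorem theorem8p1 (α p : ℝ) (hα : 0 < α) (hp : 2 < p) :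
    (∀ X : Fock.Divisor, X.IsSampling α p →
      X.FiniteOverlap α ∧
      ∃ C : ℝ, 0 < C ∧ (⋃ l ∈ X.points, Metric.ball l (X.radius α l + C)) = Set.univ) ∧
    (∀ S : ℝ≥0, ∃ C : ℝ, 0 < C ∧ ∀ X : Fock.Divisor, X.overlap α ≤ S →
      ∀ K : Set ℂ, IsCompact K →
        (⋃ l ∈ {l | l ∈ X.points ∧ α * C ^ 2 < (X.mult l : ℝ)},
          Metric.ball l (X.radius α l - C)) = Kᶜ →
        X.IsSampling α p) := by
  have hp1 : 1 < p := by linarith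
  refine ⟨fun X hX ↦ ⟨hX.finiteOverlap hα hp1, hX.exists_cover hα hp1⟩, fun S ↦ ?_⟩
  have hS0 : (S : ℝ≥0∞) + 1 ≠ 0 := by simp
  have hSt : (S : ℝ≥0∞) + 1 ≠ ∞ := by simp
  -- The depth `t` depends only on `S`, `α` and `p`. In `S + 1`, the `1` pays for the fictitious
  -- disc over `K`.
  obtain ⟨t, ht, ht', hη⟩ := Fock.exists_innerConst_lt α hp1 (η := 1 / 2 / (S + 1))
    (ENNReal.div_pos (by simp) hSt)
  have hη' : 4 ^ (p - 1) * Fock.innerConst α p t * (S + 1) ≤ 1 / 2 :=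
    (mul_le_mul_left hη.le _).trans_eq (ENNReal.div_mul_cancel hS0 hSt)
  -- The inner estimate loses `t` for the kernel cutoff and `1` for the annulus, so `C = t + 1`.
  refine ⟨t + 1, by linarith, fun X hXS K hK hcov ↦ ?_⟩
  obtain ⟨ρ, hρ⟩ := hK.isBounded.subset_closedBall 0
  obtain ⟨A, hA, hlow⟩ := Fock.exists_lower_bound hα hp1 ht ht' hXS hη' hcov.ge hK.measurableSet
    (le_max_right ρ 0) (hρ.trans (Metric.closedBall_subset_closedBall (le_max_left ρ 0)))
  obtain ⟨B, hB, hupp⟩ := Fock.Divisor.exists_upper_bound (X := X) hα hp1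
    (hXS.trans_lt ENNReal.coe_lt_top)
  exact ⟨A, B, hA, hB, fun f hf ↦ ⟨hlow f hf, hupp f hf⟩⟩
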